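/- **Conventions.** $\Lambda$ is the set of pure $\lambda$-terms over a countably infinite set $\mathsf{Var}$ of variables, $\Lambda^0$ the closed ones. Lazy evaluation on $\Lambda^0$ is generated by $\lambda x.M\Downarrow\lambda x.M$ and: if $M\Downarrow\lambda x.P$ and $P[N/x]\Downarrow Q$ then $MN\Downarrow Q$. *Transition systems.* A quasi-applicative transition system (quasi-ats) is a set $A$ with a partial map $ev:A\rightharpoonup(A\to A)$; write $a\Downarrow f$ if $ev(a)=f$, $a\Downarrow$ if $ev(a)$ is defined, and $a\Uparrow$ otherwise. $\lesssim^B$ is the largest relation $R$ such that $a\,R\,b$ and $a\Downarrow f$ imply $b\Downarrow g$ for some $g$ with $f(c)\,R\,g(c)$ for all $c\in A$; $\sim^B$ is $\lesssim^B\cap\gtrsim^B$. It is an ats if $a\Downarrow f$ and $b\lesssim^B c$ imply $f(b)\lesssim^B f(c)$. Put $a\cdot b=f(b)$ if $a\Downarrow f$, and $a\cdot b=a$ if $a\Uparrow$. A lambda transition system (lts) is an ats with $k,s\in A$ such that, for all $x,y,z$: $k$, $kx$, $s$, $sx$, $sxy$ converge, $kxy\sim^B x$ and $sxyz\sim^B(xz)(yz)$.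 A term $M\in\Lambda$ is interpreted as $[\![M]\!]_\rho\in A$ ($\rho:\mathsf{Var}\to A$) by translating $\lambda$ into combinators by $\lambda^*x.x=SKK$, $\lambda^*x.M=KM$ ($x\notin FV(M)$), $\lambda^*x.MN=S(\lambda^*x.M)(\lambda^*x.N)$ otherwise. The theory $\Im(\mathcal A)$ is the set of conditional formulae $\bigwedge_{i\in I}M_i{\Downarrow}\wedge\bigwedge_{j\in J}N_j{\Uparrow}\Rightarrow F$ ($I,J$ finite, all terms in $\Lambda$, $F$ of the form $M\sqsubseteq N$, $M=N$, $M{\Downarrow}$ or $M{\Uparrow}$) that hold in $\mathcal A$ under every $\rho$, where $\sqsubseteq$ and $=$ are read as $\lesssim^B$ and $\sim^B$. $\mathcal A$ is *sensible* if for all $M\in\Lambda^0$: $[\![M]\!]$ converges in $\mathcal A$ iff $M\Downarrow$ under lazy evaluation. *Domain logic.* $\mathcal L$ has formulae $\phi::=t\mid\phi\wedge\psi\mid(\phi\to\psi)_\bot$, and $\lambda:=(t\to t)_\bot$. In a quasi-ats, $a\models t$ always; $\wedge$ is conjunction; $a\models(\phi\to\psi)_\bot$ iff $a\Downarrow f$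 for some $f$ such that $b\models\phi$ implies $f(b)\models\psi$ for all $b$. Let $\mathcal L(a)=\{\phi: a\models\phi\}$. $\mathcal L\vdash\phi\le\psi$ is the least preorder for which $t$ is a greatest element and $\wedge$ a binary meet, $(\phi\to\psi)_\bot$ is antitone in $\phi$ and monotone in $\psi$, $(\phi\to\psi_1\wedge\psi_2)_\bot=(\phi\to\psi_1)_\bot\wedge(\phi\to\psi_2)_\bot$, and $(\phi\to t)_\bot\le(t\to t)_\bot$. $\mathcal A$ is *approximable* if whenever $ab_1\cdots b_n\Downarrow$ ($n\ge0$) there are $\phi_1,\dots,\phi_n$ with $a\models(\phi_1\to\cdots(\phi_n\to\lambda)_\bot\cdots)_\bot$ and $b_i\models\phi_i$ for all $i$. For $\Gamma:\mathsf{Var}\to\mathcal L$, $M,\Gamma\vdash\phi$ is generated by: $M,\Gamma\vdash t$; conjunction introduction; if $\Gamma x\le\Delta x$ for all $x$, $M,\Delta\vdash\phi$ and $\phi\le\psi$, then $M,\Gamma\vdash\psi$; $x,\Gamma[x\mapsto\phi]\vdash\phi$; if $M,\Gamma[x\mapsto\phi]\vdash\psi$ then $\lambda x.M,\Gamma\vdash(\phi\to\psi)_\bot$;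 if $M,\Gamma\vdash(\phi\to\psi)_\bot$ and $N,\Gamma\vdash\phi$ then $MN,\Gamma\vdash\psi$. $M,\Gamma\models_{\mathcal A}\phi$ means that $[\![M]\!]_\rho\models\phi$ for every $\rho$ with $\rho x\models\Gamma x$ for all $x$. *The domain.* $D$ is the canonical solution of $D\cong(D\to D)_\bot$ (Scott-continuous function space, lifted): the limit, along the standard projections, of $D_0=\mathbf 1$, $D_{n+1}=(D_n\to D_n)_\bot$. It is an lts with $ev(d)=f$ if $\mathsf{unfold}(d)=\mathsf{up}(f)$, $ev(d)$ undefined if $\mathsf{unfold}(d)=\bot$, and $k,s$ the denotations of $\lambda x\lambda y.x$ and $\lambda x\lambda y\lambda z.(xz)(yz)$. $K(D)$ is the set of compact elements of $D$. $t_{\mathcal A}:A\to D$ is the unique map with $a\models_{\mathcal A}\phi\iff t_{\mathcal A}(a)\models_D\phi$ for all $a,\phi$. *Definability.* *Convergence testing* $\mathsf C$ is definable in $\mathcal A$ if some $c\in A$ satisfies, for all $x$: $c\Downarrow$; $x\Uparrow\Rightarrow cx\Uparrow$; $x\Downarrow\Rightarrow cx\sim^B skk$. *Parallel convergence* $\mathsf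 P$ is definable if some $p\in A$ satisfies, for all $x,y$: $p\Downarrow$, $px\Downarrow$; $pxy\Downarrow$ whenever $x\Downarrow$ or $y\Downarrow$; $pxy\Uparrow$ whenever $x\Uparrow$ and $y\Uparrow$. *The language $\ell_{\mathsf P}$.* Its elements are the closed $\lambda$-terms over one constant $\mathsf P$. Evaluation is generated by the two rules of lazy evaluation together with $\mathsf P\Downarrow\mathsf P$; if $M\Downarrow\mathsf P$ then $MN\Downarrow\mathsf PN$; if $M\Downarrow\mathsf PM'$ and ($M'\Downarrow$ or $N\Downarrow$) then $MN\Downarrow\mathbf I=\lambda x.x$. If $M\Downarrow\lambda x.B$ then $ev(M)$ is $N\mapsto B[N/x]$; if $M\Downarrow V$ with $V=\mathsf P$ or $V=\mathsf PM'$ then $ev(M)$ is $N\mapsto VN$; otherwise $ev(M)$ is undefined; $k=\lambda x\lambda y.x$, $s=\lambda x\lambda y\lambda z.(xz)(yz)$. **Theorem (Full Abstraction).** Let $\mathcal A$ be a sensible, approximable lts in which convergence testing is definable. The following are equivalent: 1. parallel convergence is definable in $\mathcal A$; 2. $\mathcal A$ is $\mathcal L$-expressive: for every $\phi\in\mathcal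 L$ there is $a\in A$ with $\mathcal L(a)=\{\psi:\mathcal L\vdash\phi\le\psi\}$; 3. $\mathcal A$ is $\mathcal L$-complete: for all $M\in\Lambda$, $\Gamma:\mathsf{Var}\to\mathcal L$, $\phi\in\mathcal L$: $M,\Gamma\vdash\phi\iff M,\Gamma\models_{\mathcal A}\phi$; 4. $t_{\mathcal A}$ is a combinatory embedding (it preserves application, $k$ and $s$, and $t_{\mathcal A}(a)=t_{\mathcal A}(b)$ iff $a\sim^B b$) with $K(D)\subseteq\operatorname{Im}t_{\mathcal A}$; 5. $D$ is fully abstract for $\mathcal A$: $\Im(\mathcal A)=\Im(D)$. As a consequence, $\ell_{\mathsf P}$ is an lts and $D$ is fully abstract for $\ell_{\mathsf P}$. -/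

import Mathlib

namespace LazyLambda

/-! ### The domain `D = (D → D)_⊥` -/

/-- The finite approximants of the domain equation: `D₀ = 1` and `Dₙ₊₁ = (Dₙ → Dₙ)_⊥`.
Lifting is `WithBot`.  Each `Dₙ` is finite, so that the continuous maps `Dₙ → Dₙ` are exactly
the monotone ones. -/
def approxAux : ℕ → PartOrd.{0}
  | 0 => PartOrd.of PUnit
  | n + 1 => PartOrd.of (WithBot (approxAux n →o approxAux n))

/-- The `n`-th approximant `Dₙ`. -/
def Approx (n : ℕ) : Type := approxAux n

instance (n : ℕ) : PartialOrder (Approx n) := (approxAux n).str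

/-- `Dₙ₊₁` is, by definition, `(Dₙ → Dₙ)_⊥`. -/
def step (n : ℕ) : Approx (n + 1) ≃o WithBot (Approx n →o Approx n) :=
  OrderIso.refl (WithBot (Approx n →o Approx n))

/-- The unique element of `D₀`. -/
def pt : Approx 0 := PUnit.unit

/-- The least element of `Dₙ`. -/
def bot : (n : ℕ) → Approx n
  | 0 => pt
  | n + 1 => (step n).symm ⊥

theorem eq_pt (x : Approx 0) : x = pt := rfl

theorem bot_le' (n : ℕ) (x : Approx n) : bot n ≤ x := by
  cases n with
  | zero => exact le_of_eq (eq_pt x).symm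
  | succ n => exact (OrderIso.symm_apply_le (step n)).2 bot_le

instance instFiniteApprox (n : ℕ) : Finite (Approx n) := by
  induction n with
  | zero => exact inferInstanceAs (Finite PUnit)
  | succ n ih =>
    have : Finite (Approx n →o Approx n) := DFunLike.finite _
    have : Finite (WithBot (Approx n →o Approx n)) :=
      inferInstanceAs (Finite (Option (Approx n →o Approx n)))
    exact Finite.of_equiv _ (step n).symm.toEquiv

/-- The action of `(· → ·)_⊥` on a pair of maps: `up h ↦ up (f ∘ h ∘ g)` and `⊥ ↦ ⊥`. -/
def liftMap {n m : ℕ} (f : Approx n →o Approx m) (g : Approx m →o Approx n) :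
    Approx (n + 1) →o Approx (m + 1) where
  toFun x := (step m).symm ((step n x).map fun h => f.comp (h.comp g))
  monotone' x y hxy := by
    refine (step m).symm.monotone (WithBot.monotone_map_iff.2 ?_ ((step n).monotone hxy))
    intro a b hab d
    exact f.monotone (hab (g d))

/-- The canonical pair of maps between `Dₙ` and `Dₘ`, by functoriality from the trivial maps
between `D₀ = 1` and `Dₘ`: the map out of the approximant with the smaller index is an embedding,
and the map into it is the corresponding projection. -/
def connPair : (n m : ℕ) → (Approx n →o Approx m) × (Approx m →o Approx n)
  | 0, m => (⟨fun _ => bot m, fun _ _ _ => le_rfl⟩, ⟨fun _ => pt, fun _ _ _ => le_rfl⟩)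
  | _ + 1, 0 => (⟨fun _ => pt, fun _ _ _ => le_rfl⟩, ⟨fun _ => bot _, fun _ _ _ => le_rfl⟩)
  | n + 1, m + 1 =>
    (liftMap (connPair n m).1 (connPair n m).2, liftMap (connPair n m).2 (connPair n m).1)

/-- The canonical map `Dₙ → Dₘ`: the embedding if `n ≤ m`, the projection if `m ≤ n`. -/
def conn (n m : ℕ) : Approx n →o Approx m := (connPair n m).1

theorem connPair_swap (n m : ℕ) : (connPair n m).swap = connPair m n := by
  induction n generalizing m with
  | zero => cases m <;> rfl
  | succ n ih =>
    cases m with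
    | zero => rfl
    | succ m =>
      have h := ih m
      simp only [connPair, ← h, Prod.swap]

theorem conn_succ (n m : ℕ) : conn (n + 1) (m + 1) = liftMap (conn n m) (conn m n) := by
  have h := connPair_swap n m
  simp only [conn, connPair, ← h, Prod.fst_swap]

theorem step_conn (n m : ℕ) (x : Approx (n + 1)) :
    step m (conn (n + 1) (m + 1) x) =
      (step n x).map fun h => (conn n m).comp (h.comp (conn m n)) := by
  rw [conn_succ]
  exact (step m).apply_symm_apply _

theorem conn_zero (m : ℕ) (x : Approx 0) : conn 0 m x = bot m := rfl

theorem conn_conn_le (n k m : ℕ) (x : Approx n) : conn k m (conn n k x) ≤ conn n m x := by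
  induction k generalizing n m with
  | zero => exact (le_of_eq (conn_zero m _)).trans (bot_le' m _)
  | succ k ih =>
    cases n with
    | zero =>
      cases m with
      | zero => exact le_of_eq rfl
      | succ m =>
        refine le_of_eq ?_
        apply (step m).injective
        rw [step_conn, conn_zero, conn_zero]
        simp [bot]
    | succ n =>
      cases m with
      | zero => exact le_of_eq rfl
      | succ m =>
        apply (step m).le_iff_le.1
        simp only [step_conn]
        cases step n x using WithBot.recBotCoe with
        | bot => exact le_rfl
        | coe f =>
          simp only [WithBot.map_coe, WithBot.coe_le_coe]
          intro d
          exact (ih n m _).trans ((conn n m).monotone (f.monotone (ih m n d)))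

theorem conn_conn (n k m : ℕ) (h : n ≤ k ∨ m ≤ k) (x : Approx n) :
    conn k m (conn n k x) = conn n m x := by
  induction k generalizing n m with
  | zero =>
    rcases h with h | h
    · obtain rfl : n = 0 := by omega
      rfl
    · obtain rfl : m = 0 := by omega
      rfl
  | succ k ih =>
    cases n with
    | zero =>
      cases m with
      | zero => rfl
      | succ m =>
        apply (step m).injective
        rw [step_conn, conn_zero, conn_zero]
        simp [bot]
    | succ n =>
      cases m with
      | zero => rfl
      | succ m =>
        have h1 : n ≤ k ∨ m ≤ k := by omega
        apply (step m).injective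
        simp only [step_conn]
        cases step n x using WithBot.recBotCoe with
        | bot => rfl
        | coe f =>
          simp only [WithBot.map_coe, WithBot.coe_inj]
          ext d
          show conn k m (conn n k (f (conn k n (conn m k d)))) = conn n m (f (conn m n d))
          rw [ih n m h1, ih m n h1.symm]

theorem conn_self (n : ℕ) (x : Approx n) : conn n n x = x := by
  induction n with
  | zero => rfl
  | succ n ih =>
    apply (step n).injective
    rw [step_conn]
    cases step n x using WithBot.recBotCoe with
    | bot => rfl
    | coe f =>
      simp only [WithBot.map_coe, WithBot.coe_inj]
      ext d
      show conn n n (f (conn n n d)) = f d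
      rw [ih, ih]

/-- The domain `D`: the limit of the approximants `Dₙ` along the projections `Dₙ₊₁ → Dₙ`,
ordered componentwise. -/
def Dom : Type := {x : (n : ℕ) → Approx n // ∀ n, conn (n + 1) n (x (n + 1)) = x n}

instance : PartialOrder Dom :=
  inferInstanceAs (PartialOrder {x : (n : ℕ) → Approx n // ∀ n, conn (n + 1) n (x (n + 1)) = x n})

/-- The projection `D → Dₙ`. -/
def proj (n : ℕ) (x : Dom) : Approx n := x.1 n

theorem Dom.ext' {x y : Dom} (h : ∀ n, proj n x = proj n y) : x = y := Subtype.ext (funext h)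

theorem Dom.le_iff {x y : Dom} : x ≤ y ↔ ∀ n, proj n x ≤ proj n y := Iff.rfl

theorem proj_mono (n : ℕ) {x y : Dom} (h : x ≤ y) : proj n x ≤ proj n y := h n

theorem conn_proj {n m : ℕ} (h : m ≤ n) (x : Dom) : conn n m (proj n x) = proj m x := by
  induction n, h using Nat.le_induction with
  | base => exact conn_self m _
  | succ n hn ih =>
    rw [← conn_conn (n + 1) n m (Or.inr hn)]
    have : conn (n + 1) n (proj (n + 1) x) = proj n x := x.2 n
    rw [this, ih]

/-- The embedding `Dₙ → D`. -/
def emb (n : ℕ) (d : Approx n) : Dom :=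
  ⟨fun m => conn n m d, fun m => conn_conn n (m + 1) m (Or.inr (Nat.le_succ m)) d⟩

theorem proj_emb (n m : ℕ) (d : Approx n) : proj m (emb n d) = conn n m d := rfl

theorem emb_mono (n : ℕ) {d e : Approx n} (h : d ≤ e) : emb n d ≤ emb n e :=
  fun m => (conn n m).monotone h

theorem emb_conn {n m : ℕ} (h : n ≤ m) (d : Approx n) : emb m (conn n m d) = emb n d :=
  Dom.ext' fun k => conn_conn n m k (Or.inl h) d

theorem emb_proj_le (n : ℕ) (x : Dom) : emb n (proj n x) ≤ x := by
  intro m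
  show conn n m (proj n x) ≤ proj m x
  rw [← conn_proj (le_max_left n m) x, ← conn_proj (le_max_right n m) x]
  exact conn_conn_le _ _ _ _

instance : OrderBot Dom where
  bot := emb 0 pt
  bot_le x := emb_proj_le 0 x

theorem isLUB_of_proj {S : Set Dom} {x : Dom} (hb : ∀ s ∈ S, s ≤ x)
    (h : ∀ n, ∃ s ∈ S, proj n x ≤ proj n s) : IsLUB S x := by
  refine ⟨hb, fun y hy n => ?_⟩
  obtain ⟨s, hs, hle⟩ := h n
  exact hle.trans (proj_mono n (hy hs))

/-- Directed suprema exist in `D` and are computed componentwise. -/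
theorem exists_isLUB {S : Set Dom} (hne : S.Nonempty) (hS : DirectedOn (· ≤ ·) S) :
    ∃ x, IsLUB S x ∧ ∀ n, ∃ s ∈ S, proj n x = proj n s := by
  have hmax : ∀ n, ∃ s ∈ S, ∀ t ∈ S, proj n t ≤ proj n s := by
    intro n
    obtain ⟨a, ⟨s, hs, rfl⟩, ha⟩ := (Set.toFinite (proj n '' S)).exists_maximal (hne.image _)
    refine ⟨s, hs, fun t ht => ?_⟩
    obtain ⟨u, hu, hsu, htu⟩ := hS s hs t ht
    exact (proj_mono n htu).trans (ha ⟨u, hu, rfl⟩ (proj_mono n hsu))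
  choose s hs hmax using hmax
  let y : Dom := ⟨fun n => proj n (s n), fun n => by
    refine le_antisymm ?_ ?_
    · rw [show conn (n + 1) n (proj (n + 1) (s (n + 1))) = _ from conn_proj (Nat.le_succ n) _]
      exact hmax n _ (hs _)
    · show proj n (s n) ≤ conn (n + 1) n (proj (n + 1) (s (n + 1)))
      rw [← conn_proj (Nat.le_succ n) (s n)]
      exact (conn (n + 1) n).monotone (hmax (n + 1) _ (hs n))⟩
  exact ⟨y, isLUB_of_proj (fun t ht k => hmax k t ht) fun n => ⟨s n, hs n, le_rfl⟩,
    fun n => ⟨s n, hs n, rfl⟩⟩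

theorem proj_of_isLUB {S : Set Dom} (hne : S.Nonempty) (hS : DirectedOn (· ≤ ·) S) {x : Dom}
    (hx : IsLUB S x) (n : ℕ) : ∃ s ∈ S, proj n x = proj n s := by
  obtain ⟨y, hy, h⟩ := exists_isLUB hne hS
  rw [hx.unique hy]
  exact h n

/-- A map `D → D` is continuous if and only if every component of the value is determined from
below by some component of the argument. -/
theorem scottContinuous_iff {f : Dom → Dom} : ScottContinuous f ↔
    ∀ x m, ∃ n, ∀ y, proj n x ≤ proj n y → proj m (f x) ≤ proj m (f y) := by
  constructor
  · intro hf x m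
    have hmono : Monotone f := hf.monotone
    have hdir : DirectedOn (· ≤ ·) (Set.range fun n => emb n (proj n x)) := by
      rintro _ ⟨n, rfl⟩ _ ⟨k, rfl⟩
      refine ⟨_, ⟨max n k, rfl⟩, ?_, ?_⟩
      · show emb n (proj n x) ≤ emb (max n k) (proj (max n k) x)
        rw [← emb_conn (le_max_left n k)]
        exact emb_mono _ (emb_proj_le n x (max n k))
      · show emb k (proj k x) ≤ emb (max n k) (proj (max n k) x)
        rw [← emb_conn (le_max_right n k)]
        exact emb_mono _ (emb_proj_le k x (max n k))
    have hlub : IsLUB (Set.range fun n => emb n (proj n x)) x := by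
      refine isLUB_of_proj ?_ fun n => ⟨_, ⟨n, rfl⟩, ?_⟩
      · rintro _ ⟨n, rfl⟩
        exact emb_proj_le n x
      · exact le_of_eq (conn_self n _).symm
    have hdir' : DirectedOn (· ≤ ·) (f '' Set.range fun n => emb n (proj n x)) := by
      rintro _ ⟨a, ha, rfl⟩ _ ⟨b, hb, rfl⟩
      obtain ⟨c, hc, hac, hbc⟩ := hdir a ha b hb
      exact ⟨f c, ⟨c, hc, rfl⟩, hmono hac, hmono hbc⟩
    obtain ⟨_, ⟨_, ⟨n, rfl⟩, rfl⟩, h⟩ :=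
      proj_of_isLUB ((Set.range_nonempty _).image f) hdir'
        (hf (Set.range_nonempty _) hdir hlub) m
    refine ⟨n, fun y hy => ?_⟩
    rw [h]
    exact proj_mono m (hmono ((emb_mono n hy).trans (emb_proj_le n y)))
  · intro h S hne hS x hx
    refine isLUB_of_proj ?_ fun m => ?_
    · rintro _ ⟨s, hs, rfl⟩ m
      obtain ⟨n, hn⟩ := h s m
      exact hn x (proj_mono n (hx.1 hs))
    · obtain ⟨n, hn⟩ := h x m
      obtain ⟨s, hs, hxs⟩ := proj_of_isLUB hne hS hx n
      exact ⟨f s, ⟨s, hs, rfl⟩, hn s hxs.le⟩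

/-- The function space `D → D`: the Scott continuous maps, ordered pointwise. -/
abbrev ContFun : Type := {f : Dom → Dom // ScottContinuous f}

theorem ContFun.mono (g : ContFun) : Monotone g.1 := g.2.monotone

/-- The element of `D` that represents a continuous map `g`: its `0`-th component is the element of
`D₀`, and its `(n+1)`-st component is `up (projₙ ∘ g ∘ embₙ)`. -/
def foldFun (g : ContFun) : Dom :=
  ⟨fun
    | 0 => pt
    | n + 1 => (step n).symm
        ((⟨fun d => proj n (g.1 (emb n d)),
          fun _ _ h => proj_mono n (g.mono (emb_mono n h))⟩ : Approx n →o Approx n) :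
          WithBot (Approx n →o Approx n)), by
    intro n
    cases n with
    | zero => rfl
    | succ n =>
      apply (step n).injective
      rw [step_conn]
      simp only [OrderIso.apply_symm_apply, WithBot.map_coe, WithBot.coe_inj]
      ext d
      show conn (n + 1) n (proj (n + 1) (g.1 (emb (n + 1) (conn n (n + 1) d)))) =
        proj n (g.1 (emb n d))
      rw [emb_conn (Nat.le_succ n), conn_proj (Nat.le_succ n)]⟩

theorem step_proj_foldFun (g : ContFun) (n : ℕ) :
    step n (proj (n + 1) (foldFun g)) =
      ((⟨fun d => proj n (g.1 (emb n d)),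
        fun _ _ h => proj_mono n (g.mono (emb_mono n h))⟩ : Approx n →o Approx n) :
        WithBot (Approx n →o Approx n)) :=
  (step n).apply_symm_apply _

theorem step_proj_bot (n : ℕ) : step n (proj (n + 1) ⊥) = ⊥ :=
  (step n).apply_symm_apply _

theorem eq_bot_of_step {x : Dom} (h : step 0 (proj 1 x) = ⊥) : x = ⊥ := by
  refine Dom.ext' fun n => ?_
  cases n with
  | zero => rfl
  | succ n =>
    apply (step n).injective
    rw [step_proj_bot]
    rw [← conn_proj (Nat.succ_le_succ (Nat.zero_le n)) x, step_conn] at h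
    exact WithBot.map_eq_bot_iff.1 h

/-- The map `fold : (D → D)_⊥ → D`. -/
def foldMap (u : WithBot ContFun) : Dom := u.recBotCoe ⊥ foldFun

theorem foldMap_le_iff (u v : WithBot ContFun) : foldMap u ≤ foldMap v ↔ u ≤ v := by
  cases u using WithBot.recBotCoe with
  | bot => exact ⟨fun _ => bot_le, fun _ => bot_le⟩
  | coe f =>
    cases v using WithBot.recBotCoe with
    | bot =>
      constructor
      · intro h
        have h1 := (step 0).monotone (proj_mono 1 h)
        rw [show foldMap (⊥ : WithBot ContFun) = ⊥ from rfl, step_proj_bot,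
          show foldMap (f : WithBot ContFun) = foldFun f from rfl, step_proj_foldFun] at h1
        exact absurd h1 (WithBot.not_coe_le_bot _)
      · intro h
        exact absurd h (WithBot.not_coe_le_bot _)
    | coe g =>
      rw [WithBot.coe_le_coe]
      show foldFun f ≤ foldFun g ↔ f ≤ g
      constructor
      · intro h
        have h1 : ∀ n d, proj n (f.1 (emb n d)) ≤ proj n (g.1 (emb n d)) := by
          intro n
          have h1 := (step n).monotone (proj_mono (n + 1) h)
          rw [step_proj_foldFun, step_proj_foldFun, WithBot.coe_le_coe] at h1
          exact h1
        intro x m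
        obtain ⟨k, hk⟩ := scottContinuous_iff.1 f.2 x m
        have h2 := hk (emb k (proj k x)) (le_of_eq (conn_self k _).symm)
        refine h2.trans ?_
        refine le_trans ?_ (proj_mono m (g.mono (emb_proj_le k x)))
        rw [← emb_conn (le_max_left k m), ← conn_proj (le_max_right k m),
          ← conn_proj (le_max_right k m) (g.1 _)]
        exact (conn _ m).monotone (h1 _ _)
      · intro h n
        cases n with
        | zero => exact le_rfl
        | succ n =>
          apply (step n).le_iff_le.1
          show step n (proj (n + 1) (foldFun f)) ≤ step n (proj (n + 1) (foldFun g))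
          rw [step_proj_foldFun, step_proj_foldFun, WithBot.coe_le_coe]
          exact fun d => h (emb n d) n

theorem foldMap_surjective : Function.Surjective foldMap := by
  intro x
  by_cases hx : step 0 (proj 1 x) = ⊥
  · exact ⟨⊥, (eq_bot_of_step hx).symm⟩
  have hf : ∀ n, ∃ f : Approx n →o Approx n, step n (proj (n + 1) x) = f := by
    intro n
    rw [← conn_proj (Nat.succ_le_succ (Nat.zero_le n)) x, step_conn] at hx
    cases h : step n (proj (n + 1) x) using WithBot.recBotCoe with
    | bot => exact absurd (by rw [h]; rfl) hx
    | coe f => exact ⟨f, rfl⟩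
  choose f hf using hf
  have hcomp : ∀ n k, n ≤ k → ∀ d, conn k n (f k (conn n k d)) = f n d := by
    intro n k hnk d
    have h := conn_proj (Nat.succ_le_succ hnk) x
    apply_fun step n at h
    rw [step_conn, hf, hf, WithBot.map_coe, WithBot.coe_inj] at h
    exact DFunLike.congr_fun h d
  let e : Dom → ℕ → Dom := fun y k => emb k (f k (proj k y))
  have he : ∀ y, Monotone (e y) := by
    intro y
    refine monotone_nat_of_le_succ fun k m => ?_
    show conn k m (f k (proj k y)) ≤ conn (k + 1) m (f (k + 1) (proj (k + 1) y))
    rw [← hcomp k (k + 1) (Nat.le_succ k)]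
    refine (conn_conn_le _ _ _ _).trans ((conn _ m).monotone ((f (k + 1)).monotone ?_))
    exact emb_proj_le k y (k + 1)
  have hF : ∀ y, ∃ z, IsLUB (Set.range (e y)) z ∧ ∀ n, ∃ k, proj n z = proj n (e y k) := by
    intro y
    obtain ⟨z, hz, h⟩ := exists_isLUB (Set.range_nonempty (e y)) (directedOn_range.2 (he y).directed_le)
    refine ⟨z, hz, fun n => ?_⟩
    obtain ⟨_, ⟨k, rfl⟩, hk⟩ := h n
    exact ⟨k, hk⟩
  choose F hF hFe using hF
  have hcont : ScottContinuous F := by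
    refine scottContinuous_iff.2 fun y m => ?_
    obtain ⟨k, hk⟩ := hFe y m
    refine ⟨k, fun z hz => ?_⟩
    rw [hk]
    refine le_trans ?_ (proj_mono m ((hF z).1 ⟨k, rfl⟩))
    exact (conn k m).monotone ((f k).monotone hz)
  refine ⟨((⟨F, hcont⟩ : ContFun) : WithBot ContFun), Dom.ext' fun n => ?_⟩
  cases n with
  | zero => rfl
  | succ n =>
    apply (step n).injective
    rw [show foldMap ((⟨F, hcont⟩ : ContFun) : WithBot ContFun) = foldFun ⟨F, hcont⟩ from rfl,
      step_proj_foldFun, hf, WithBot.coe_inj]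
    ext d
    show proj n (F (emb n d)) = f n d
    apply le_antisymm
    · obtain ⟨k, hk⟩ := hFe (emb n d) n
      rw [hk]
      refine (proj_mono n (he _ (le_max_left k n))).trans (le_of_eq ?_)
      exact hcomp n _ (le_max_right k n) d
    · refine le_trans (le_of_eq ?_) (proj_mono n ((hF (emb n d)).1 ⟨n, rfl⟩))
      exact (hcomp n n le_rfl d).symm

/-- The isomorphism `fold : (D → D)_⊥ ≅ D`. -/
noncomputable def fold : WithBot ContFun ≃o Dom :=
  RelIso.ofSurjective (OrderEmbedding.ofMapLEIff foldMap foldMap_le_iff) foldMap_surjective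

/-- The inverse isomorphism `unfold : D ≅ (D → D)_⊥`. -/
noncomputable def unfold : Dom ≃o WithBot ContFun := fold.symm

/-- Application on `D`: `lift(Ap) (unfold d) e`. -/
noncomputable def domApp (d e : Dom) : Dom := (unfold d).recBotCoe ⊥ fun g => g.1 e

/-- The element `fold (up g)` of `D` denoted by an abstraction with continuous body `g`. -/
noncomputable def abs (g : Dom → Dom) (hg : ScottContinuous g) : Dom :=
  fold ((⟨g, hg⟩ : ContFun) : WithBot ContFun)

theorem domApp_cont (x y : Dom) (m : ℕ) : ∃ n, ∀ x' y', proj n x ≤ proj n x' →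
    proj n y ≤ proj n y' → proj m (domApp x y) ≤ proj m (domApp x' y') := by
  obtain ⟨u, rfl⟩ := fold.surjective x
  cases u using WithBot.recBotCoe with
  | bot =>
    refine ⟨0, fun x' y' _ _ => ?_⟩
    rw [show domApp (fold ⊥) y = ⊥ by simp [domApp, unfold]]
    exact proj_mono m bot_le
  | coe g =>
    obtain ⟨k, hk⟩ := scottContinuous_iff.1 g.2 y m
    refine ⟨max k m + 1, fun x' y' hx hy => ?_⟩
    obtain ⟨v, rfl⟩ := fold.surjective x'
    have hx1 := (step _).monotone hx
    rw [show fold (g : WithBot ContFun) = foldFun g from rfl, step_proj_foldFun] at hx1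
    cases v using WithBot.recBotCoe with
    | bot =>
      rw [show fold ⊥ = ⊥ from rfl, step_proj_bot] at hx1
      exact absurd hx1 (WithBot.not_coe_le_bot _)
    | coe g' =>
      rw [show fold (g' : WithBot ContFun) = foldFun g' from rfl, step_proj_foldFun,
        WithBot.coe_le_coe] at hx1
      have e1 : ∀ (h : ContFun) z, domApp (fold (h : WithBot ContFun)) z = h.1 z := by
        intro h z
        simp [domApp, unfold]
      rw [e1, e1]
      have hle : max k m ≤ max k m + 1 := Nat.le_succ _
      have hy1 : proj (max k m) y ≤ proj (max k m) y' := by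
        rw [← conn_proj hle y, ← conn_proj hle y']
        exact (conn _ _).monotone hy
      refine (hk (emb (max k m) (proj (max k m) y)) ?_).trans ?_
      · rw [proj_emb, conn_proj (le_max_left k m)]
      · have h2 := hx1 (proj (max k m) y)
        have h3 := (conn (max k m) m).monotone h2
        have h4 : proj m (g.1 (emb (max k m) (proj (max k m) y))) ≤
            proj m (g'.1 (emb (max k m) (proj (max k m) y))) := by
          rw [← conn_proj (le_max_right k m), ← conn_proj (le_max_right k m) (g'.1 _)]
          exact h3
        exact h4.trans (proj_mono m (g'.mono ((emb_mono _ hy1).trans (emb_proj_le _ y'))))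

theorem domApp_comp {f g : Dom → Dom} (hf : ScottContinuous f) (hg : ScottContinuous g) :
    ScottContinuous fun d => domApp (f d) (g d) := by
  refine scottContinuous_iff.2 fun x m => ?_
  obtain ⟨n, hn⟩ := domApp_cont (f x) (g x) m
  obtain ⟨n1, h1⟩ := scottContinuous_iff.1 hf x n
  obtain ⟨n2, h2⟩ := scottContinuous_iff.1 hg x n
  refine ⟨max n1 n2, fun y hy => hn _ _ (h1 y ?_) (h2 y ?_)⟩
  · rw [← conn_proj (le_max_left n1 n2) x, ← conn_proj (le_max_left n1 n2) y]
    exact (conn _ _).monotone hy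
  · rw [← conn_proj (le_max_right n1 n2) x, ← conn_proj (le_max_right n1 n2) y]
    exact (conn _ _).monotone hy

theorem abs_comp {g : Dom → Dom → Dom} (h1 : ∀ d, ScottContinuous (g d))
    (h2 : ∀ e, ScottContinuous fun d => g d e) : ScottContinuous fun d => abs (g d) (h1 d) := by
  refine scottContinuous_iff.2 fun x m => ?_
  cases m with
  | zero => exact ⟨0, fun _ _ => le_rfl⟩
  | succ m =>
    have hn : ∀ e : Approx m, ∃ n, ∀ y, proj n x ≤ proj n y →
        proj m (g x (emb m e)) ≤ proj m (g y (emb m e)) :=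
      fun e => scottContinuous_iff.1 (h2 (emb m e)) x m
    choose n hn using hn
    obtain ⟨N, hN⟩ := (Set.finite_range n).bddAbove
    refine ⟨N, fun y hy => ?_⟩
    apply (step m).le_iff_le.1
    show step m (proj (m + 1) (foldFun _)) ≤ step m (proj (m + 1) (foldFun _))
    rw [step_proj_foldFun, step_proj_foldFun, WithBot.coe_le_coe]
    intro e
    refine hn e y ?_
    have hle : n e ≤ N := hN ⟨e, rfl⟩
    rw [← conn_proj hle x, ← conn_proj hle y]
    exact (conn _ _).monotone hy

theorem cont_id : ScottContinuous fun d : Dom => d := ScottContinuous.id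

theorem cont_const (c : Dom) : ScottContinuous fun _ : Dom => c := ScottContinuous.const c

/-- The denotation of `λx.λy.x` in `D`. -/
noncomputable def domK : Dom :=
  abs (fun x => abs (fun _ => x) (cont_const x)) (abs_comp _ fun _ => cont_id)

theorem domS_aux (x y : Dom) : ScottContinuous fun z => domApp (domApp x z) (domApp y z) :=
  domApp_comp (domApp_comp (cont_const x) cont_id) (domApp_comp (cont_const y) cont_id)

theorem domS_aux₁ (x : Dom) : ScottContinuous fun y => abs _ (domS_aux x y) :=
  abs_comp _ fun z =>
    domApp_comp (cont_const (domApp x z)) (domApp_comp cont_id (cont_const z))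

theorem domS_aux₂ : ScottContinuous fun x => abs _ (domS_aux₁ x) :=
  abs_comp _ fun y => abs_comp _ fun z =>
    domApp_comp (domApp_comp cont_id (cont_const z)) (cont_const (domApp y z))

/-- The denotation of `λx.λy.λz.(xz)(yz)` in `D`. -/
noncomputable def domS : Dom := abs _ domS_aux₂

/-! ### Applicative transition systems -/

/-- A quasi-applicative transition system: a partial function `ev : A ⇀ (A → A)`. -/
structure QATS (A : Type*) where
  ev : A → Option (A → A)

namespace QATS

variable {A : Type*} (𝒜 : QATS A)

/-- `a ⇓`. -/
def Conv (a : A) : Prop := ∃ f, 𝒜.ev a = some f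

/-- `a ⇑`. -/
def Div (a : A) : Prop := ¬ 𝒜.Conv a

/-- `R` is an applicative bisimulation. -/
def IsBisim (R : A → A → Prop) : Prop :=
  ∀ a b, R a b → ∀ f, 𝒜.ev a = some f → ∃ g, 𝒜.ev b = some g ∧ ∀ c, R (f c) (g c)

/-- The applicative bisimulation preorder: the union of all applicative bisimulations. -/
def Le (a b : A) : Prop := ∃ R : A → A → Prop, 𝒜.IsBisim R ∧ R a b

/-- The applicative bisimulation equivalence. -/
def Equiv (a b : A) : Prop := 𝒜.Le a b ∧ 𝒜.Le b a

/-- The condition that makes a quasi-ats an applicative transition system (ats). -/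
def IsATS : Prop := ∀ a b c f, 𝒜.ev a = some f → 𝒜.Le b c → 𝒜.Le (f b) (f c)

/-- The derived application: `a · b = f b` if `a ⇓ f`, and `a · b = a` if `a ⇑`. -/
def app (a b : A) : A :=
  match 𝒜.ev a with
  | some f => f b
  | none => a

end QATS

/-! ### The domain logic `ℒ` -/

/-- The formulae of `ℒ`: `t`, `φ ∧ ψ` and `(φ → ψ)_⊥`. -/
inductive Fml : Type
  | top : Fml
  | and : Fml → Fml → Fml
  | arrow : Fml → Fml → Fml

namespace Fml

/-- The formula `λ = (t → t)_⊥`, which expresses convergence. -/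
def lam : Fml := arrow top top

/-- Derivability `ℒ ⊢ φ ≤ ψ`; an equation stands for the two inequalities. -/
inductive Entails : Fml → Fml → Prop
  | refl (φ) : Entails φ φ
  | trans {φ ψ χ} : Entails φ ψ → Entails ψ χ → Entails φ χ
  | le_top (φ) : Entails φ top
  | and_intro {φ ψ χ} : Entails φ ψ → Entails φ χ → Entails φ (and ψ χ)
  | and_left (φ ψ) : Entails (and φ ψ) φ
  | and_right (φ ψ) : Entails (and φ ψ) ψ
  | arrow_mono {φ₁ φ₂ ψ₁ ψ₂} : Entails φ₂ φ₁ → Entails ψ₁ ψ₂ →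
      Entails (arrow φ₁ ψ₁) (arrow φ₂ ψ₂)
  | arrow_and (φ ψ₁ ψ₂) :
      Entails (arrow φ (and ψ₁ ψ₂)) (and (arrow φ ψ₁) (arrow φ ψ₂))
  | and_arrow (φ ψ₁ ψ₂) :
      Entails (and (arrow φ ψ₁) (arrow φ ψ₂)) (arrow φ (and ψ₁ ψ₂))
  | arrow_top (φ) : Entails (arrow φ top) (arrow top top)

end Fml

namespace QATS

variable {A : Type*} (𝒜 : QATS A)

/-- Satisfaction `a ⊨ φ`. -/
def Sat : A → Fml → Prop
  | _, .top => True
  | a, .and φ ψ => Sat a φ ∧ Sat a ψ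
  | a, .arrow φ ψ => ∃ f, 𝒜.ev a = some f ∧ ∀ b, Sat b φ → Sat (f b) ψ

/-- Approximability: if `a b₁ ⋯ bₙ ⇓`, then there are formulae `φᵢ` with `bᵢ ⊨ φᵢ` for all `i` and
`a ⊨ (φ₁ → ⋯ (φₙ → λ)_⊥ ⋯)_⊥`. -/
def Approximable : Prop :=
  ∀ (a : A) (bs : List A), 𝒜.Conv (bs.foldl 𝒜.app a) →
    ∃ φs : List Fml, List.Forall₂ 𝒜.Sat bs φs ∧ 𝒜.Sat a (φs.foldr Fml.arrow Fml.lam)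

/-- `ℒ`-expressiveness: every `φ` has an `a` with `ℒ(a) = ↑φ`. -/
def Expressive : Prop := ∀ φ, ∃ a, ∀ ψ, 𝒜.Sat a ψ ↔ Fml.Entails φ ψ

end QATS

/-! ### Terms -/

/-- The `λ`-terms over a set `C` of constants; the variables are the natural numbers. -/
inductive Lam (C : Type) : Type
  | var : ℕ → Lam C
  | const : C → Lam C
  | app : Lam C → Lam C → Lam C
  | lam : ℕ → Lam C → Lam C

/-- The pure `λ`-terms. -/
abbrev PureLam : Type := Lam Empty

namespace Lam

variable {C : Type}

/-- Free variables. -/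
def fv : Lam C → Finset ℕ
  | var x => {x}
  | const _ => ∅
  | app M N => fv M ∪ fv N
  | lam x M => fv M \ {x}

/-- Substitution `M[N/x]`; it is only used for closed `N`, where no variable can be captured. -/
def subst (x : ℕ) (N : Lam C) : Lam C → Lam C
  | var y => if y = x then N else var y
  | const c => const c
  | app M M' => app (subst x N M) (subst x N M')
  | lam y M => if y = x then lam y M else lam y (subst x N M)

/-- Lazy evaluation `M ⇓ V` of closed pure terms. -/
inductive Eval : PureLam → PureLam → Prop
  | lam (x M) : Eval (lam x M) (lam x M)
  | app {M N x P Q} : Eval M (lam x P) → Eval (subst x N P) Q → Eval (app M N) Q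

theorem fv_subst (x : ℕ) {N : Lam C} (hN : N.fv = ∅) (M : Lam C) :
    (subst x N M).fv = M.fv \ {x} := by
  induction M with
  | var y =>
    by_cases h : y = x
    · simp [subst, h, fv, hN]
    · simp [subst, h, fv, Finset.sdiff_singleton_eq_erase, Ne.symm h]
  | const c => simp [subst, fv]
  | app M M' h h' => simp [subst, fv, h, h', Finset.union_sdiff_distrib]
  | lam y M h =>
    by_cases hy : y = x
    · simp [subst, hy, fv]
    · simp [subst, hy, fv, h, sdiff_sdiff_comm]

end Lam

/-- The combinatory terms over `A`. -/
inductive CL (A : Type*)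
  | var : ℕ → CL A
  | const : A → CL A
  | app : CL A → CL A → CL A

namespace CL

variable {A : Type*}

/-- Free variables. -/
def fv : CL A → Finset ℕ
  | var x => {x}
  | const _ => ∅
  | app M N => fv M ∪ fv N

/-- The interpretation of combinatory terms. -/
def eval (𝒜 : QATS A) (ρ : ℕ → A) : CL A → A
  | var x => ρ x
  | const a => a
  | app M N => 𝒜.app (eval 𝒜 ρ M) (eval 𝒜 ρ N)

/-- Bracket abstraction `λ*x.M` with respect to the elements `k` and `s`. -/
def bracket (k s : A) (x : ℕ) : CL A → CL A
  | var y => if y = x then app (app (const s) (const k)) (const k) else app (const k) (var y)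
  | const a => app (const k) (const a)
  | app M N =>
    if x ∈ fv (app M N) then app (app (const s) (bracket k s x M)) (bracket k s x N)
    else app (const k) (app M N)

end CL

/-- The translation of pure `λ`-terms into combinatory terms. -/
def Lam.toCL {A : Type*} (k s : A) : PureLam → CL A
  | .var x => .var x
  | .app M N => .app (toCL k s M) (toCL k s N)
  | .lam x M => CL.bracket k s x (toCL k s M)

/-! ### Lambda transition systems -/

/-- The data `(A, ev, k, s)` of a lambda transition system. -/
structure LTS (A : Type*) extends QATS A where
  k : A
  s : A

/-- Atomic formulae over pure terms: `M ⊑ N`, `M = N`, `M ⇓`, `M ⇑`. -/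
inductive AtomicFml : Type
  | le : PureLam → PureLam → AtomicFml
  | eq : PureLam → PureLam → AtomicFml
  | conv : PureLam → AtomicFml
  | div : PureLam → AtomicFml

/-- Conditional formulae `⋀ᵢ Mᵢ ⇓ ∧ ⋀ⱼ Nⱼ ⇑ ⇒ F`, with `F` atomic. -/
structure CondFml : Type where
  convs : List PureLam
  divs : List PureLam
  concl : AtomicFml

/-- Derivability `M, Γ ⊢ φ` in the program logic. -/
inductive Derives : PureLam → (ℕ → Fml) → Fml → Prop
  | top (M Γ) : Derives M Γ Fml.top
  | and {M Γ φ ψ} : Derives M Γ φ → Derives M Γ ψ → Derives M Γ (Fml.and φ ψ)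
  | leq {M Γ Δ φ ψ} : (∀ x, Fml.Entails (Γ x) (Δ x)) → Derives M Δ φ → Fml.Entails φ ψ →
      Derives M Γ ψ
  | var (x Γ φ) : Derives (Lam.var x) (Function.update Γ x φ) φ
  | abs {M Γ x φ ψ} : Derives M (Function.update Γ x φ) ψ →
      Derives (Lam.lam x M) Γ (Fml.arrow φ ψ)
  | app {M N Γ φ ψ} : Derives M Γ (Fml.arrow φ ψ) → Derives N Γ φ → Derives (Lam.app M N) Γ ψ

namespace LTS

variable {A : Type*} (𝒜 : LTS A)

/-- The axioms of a lambda transition system (lts). -/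
structure IsLTS : Prop where
  isATS : 𝒜.IsATS
  k_conv : 𝒜.Conv 𝒜.k
  k_conv₁ : ∀ x, 𝒜.Conv (𝒜.app 𝒜.k x)
  k_app : ∀ x y, 𝒜.Equiv (𝒜.app (𝒜.app 𝒜.k x) y) x
  s_conv : 𝒜.Conv 𝒜.s
  s_conv₁ : ∀ x, 𝒜.Conv (𝒜.app 𝒜.s x)
  s_conv₂ : ∀ x y, 𝒜.Conv (𝒜.app (𝒜.app 𝒜.s x) y)
  s_app : ∀ x y z, 𝒜.Equiv (𝒜.app (𝒜.app (𝒜.app 𝒜.s x) y) z) (𝒜.app (𝒜.app x z) (𝒜.app y z))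

/-- The interpretation `⟦M⟧_ρ` of a pure `λ`-term. -/
def interp (ρ : ℕ → A) (M : PureLam) : A := (M.toCL 𝒜.k 𝒜.s).eval 𝒜.toQATS ρ

/-- The element `I = S K K`. -/
def i : A := 𝒜.app (𝒜.app 𝒜.s 𝒜.k) 𝒜.k

/-- Sensibility: a closed pure term converges in `𝒜` if and only if it converges under lazy
evaluation. -/
def Sensible : Prop :=
  ∀ M : PureLam, M.fv = ∅ → ((∀ ρ, 𝒜.Conv (𝒜.interp ρ M)) ↔ ∃ V, Lam.Eval M V)

/-- Convergence testing is definable. -/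
def ConvTestDefinable : Prop :=
  ∃ c, 𝒜.Conv c ∧ (∀ x, 𝒜.Div x → 𝒜.Div (𝒜.app c x)) ∧
    ∀ x, 𝒜.Conv x → 𝒜.Equiv (𝒜.app c x) 𝒜.i

/-- Parallel convergence is definable. -/
def ParConvDefinable : Prop :=
  ∃ p, 𝒜.Conv p ∧ (∀ x, 𝒜.Conv (𝒜.app p x)) ∧
    (∀ x y, 𝒜.Conv x → 𝒜.Conv (𝒜.app (𝒜.app p x) y)) ∧
    (∀ x y, 𝒜.Conv y → 𝒜.Conv (𝒜.app (𝒜.app p x) y)) ∧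
    ∀ x y, 𝒜.Div x → 𝒜.Div y → 𝒜.Div (𝒜.app (𝒜.app p x) y)

/-- Semantic validity `M, Γ ⊨ φ`. -/
def Models (M : PureLam) (Γ : ℕ → Fml) (φ : Fml) : Prop :=
  ∀ ρ : ℕ → A, (∀ x, 𝒜.Sat (ρ x) (Γ x)) → 𝒜.Sat (𝒜.interp ρ M) φ

/-- `ℒ`-completeness. -/
def Complete : Prop := ∀ M Γ φ, Derives M Γ φ ↔ 𝒜.Models M Γ φ

/-- Satisfaction of an atomic formula in an environment. -/
def SatAtomic (ρ : ℕ → A) : AtomicFml → Prop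
  | .le M N => 𝒜.Le (𝒜.interp ρ M) (𝒜.interp ρ N)
  | .eq M N => 𝒜.Equiv (𝒜.interp ρ M) (𝒜.interp ρ N)
  | .conv M => 𝒜.Conv (𝒜.interp ρ M)
  | .div M => 𝒜.Div (𝒜.interp ρ M)

/-- The theory of `𝒜`: the conditional formulae that hold in every environment. -/
def theory : Set CondFml :=
  {F | ∀ ρ : ℕ → A, (∀ M ∈ F.convs, 𝒜.Conv (𝒜.interp ρ M)) →
    (∀ N ∈ F.divs, 𝒜.Div (𝒜.interp ρ N)) → 𝒜.SatAtomic ρ F.concl}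

end LTS

/-! ### `D` as a lambda transition system -/

/-- `D` with `ev d = f` if `unfold d = up f`, and `ev d` undefined if `unfold d = ⊥`. -/
noncomputable def domLTS : LTS Dom where
  ev d := (unfold d).recBotCoe none fun g => some g.1
  k := domK
  s := domS

namespace LTS

variable {A : Type*} (𝒜 : LTS A)

/-- `D` is fully abstract for `𝒜`. -/
def FullyAbstract : Prop := 𝒜.theory = domLTS.theory

/-- A morphism of transition systems from `𝒜` to `D`: a map that preserves and reflects the
satisfaction of formulae. -/
def IsMorphism (t : A → Dom) : Prop := ∀ a φ, 𝒜.Sat a φ ↔ domLTS.Sat (t a) φ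

/-- `t` is the map `t_𝒜`, the unique morphism from `𝒜` to `D`. -/
def IsCanonicalMap (t : A → Dom) : Prop := 𝒜.IsMorphism t ∧ ∀ t', 𝒜.IsMorphism t' → t' = t

/-- `t` preserves application, `k` and `s`, and is injective modulo bisimulation. -/
structure IsCombinatoryEmbedding (t : A → Dom) : Prop where
  map_app : ∀ a b, t (𝒜.app a b) = domLTS.app (t a) (t b)
  map_k : t 𝒜.k = domLTS.k
  map_s : t 𝒜.s = domLTS.s
  injective : ∀ a b, t a = t b ↔ 𝒜.Equiv a b

end LTS

/-! ### The language `ℓ_P` -/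

/-- The `λ`-terms over the single constant `P`. -/
abbrev PLam : Type := Lam Unit

namespace PLam

open Lam

/-- The constant `P`. -/
def P : PLam := const ()

/-- The term `I`. -/
def I : PLam := lam 0 (var 0)

/-- Evaluation `M ⇓ V` of closed terms over `P`; the head of an application is evaluated first. -/
inductive Eval : PLam → PLam → Prop
  | lam (x M) : Eval (lam x M) (lam x M)
  | beta {M N x B Q} : Eval M (lam x B) → Eval (subst x N B) Q → Eval (app M N) Q
  | par : Eval P P
  | par₁ {M N} : Eval M P → Eval (app M N) (app P N)
  | left {M N M' V} : Eval M (app P M') → Eval M' V → Eval (app M N) I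
  | right {M N M' V} : Eval M (app P M') → Eval N V → Eval (app M N) I

/-- The result of supplying the argument `N` to a value: `B[N/x]` for `λx.B`, and otherwise the
application of the value to `N`. -/
def applyVal : PLam → PLam → PLam
  | lam x B, N => subst x N B
  | V, N => app V N

theorem Eval.closed {M V : PLam} (h : Eval M V) (hM : M.fv = ∅) : V.fv = ∅ := by
  induction h with
  | lam x M => exact hM
  | beta h1 h2 ih1 ih2 =>
    simp only [fv, Finset.union_eq_empty] at hM
    refine ih2 ?_
    rw [fv_subst _ hM.2]
    exact ih1 hM.1
  | par => rfl
  | par₁ h ih =>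
    simp only [fv, Finset.union_eq_empty] at hM ⊢
    exact ⟨rfl, hM.2⟩
  | left h1 h2 ih1 ih2 => rfl
  | right h1 h2 ih1 ih2 => rfl

theorem Eval.unique {M V W : PLam} (h : Eval M V) (h' : Eval M W) : V = W := by
  induction h generalizing W with
  | lam x M => cases h'; rfl
  | beta h1 h2 ih1 ih2 =>
    cases h' with
    | beta h3 h4 =>
      obtain ⟨rfl, rfl⟩ := Lam.lam.inj (ih1 h3)
      exact ih2 h4
    | par₁ h3 => exact absurd (ih1 h3) (by simp [P])
    | left h3 _ => exact absurd (ih1 h3) (by simp)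
    | right h3 _ => exact absurd (ih1 h3) (by simp)
  | par => cases h'; rfl
  | par₁ h1 ih1 =>
    cases h' with
    | beta h3 h4 => exact absurd (ih1 h3) (by simp [P])
    | par₁ h3 => rfl
    | left h3 _ => exact absurd (ih1 h3) (by simp [P])
    | right h3 _ => exact absurd (ih1 h3) (by simp [P])
  | left h1 h2 ih1 ih2 =>
    cases h' with
    | beta h3 h4 => exact absurd (ih1 h3) (by simp)
    | par₁ h3 => exact absurd (ih1 h3) (by simp [P])
    | left h3 _ => rfl
    | right h3 _ => rfl
  | right h1 h2 ih1 ih2 =>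
    cases h' with
    | beta h3 h4 => exact absurd (ih1 h3) (by simp)
    | par₁ h3 => exact absurd (ih1 h3) (by simp [P])
    | left h3 _ => rfl
    | right h3 _ => rfl

theorem applyVal_closed {V N : PLam} (hV : V.fv = ∅) (hN : N.fv = ∅) :
    (applyVal V N).fv = ∅ := by
  cases V with
  | lam x B =>
    simp only [applyVal, fv_subst x hN]
    exact hV
  | var x => simp [fv] at hV
  | const c => simp [applyVal, fv, hN]
  | app M M' =>
    simp only [fv] at hV
    simp [applyVal, fv, hN, hV]

/-- The closed terms over `P`. -/
def Closed : Type := {M : PLam // M.fv = ∅}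

open Classical in
/-- The lambda transition system `ℓ_P` of closed terms over `P`. -/
noncomputable def ellP : LTS Closed where
  ev M :=
    if h : ∃ V, Eval M.1 V then
      some fun N => ⟨applyVal h.choose N.1, applyVal_closed (h.choose_spec.closed M.2) N.2⟩
    else none
  k := ⟨lam 0 (lam 1 (var 0)), by decide⟩
  s := ⟨lam 0 (lam 1 (lam 2 (app (app (var 0) (var 2)) (app (var 1) (var 2))))), by decide⟩

end PLam

end LazyLambda

/-!
Write `L(a)` for the set of formulae that `a` satisfies.  The argument rests on three facts.

*Logic and bisimulation.*  In an approximable quasi-ats the bisimulation preorder is inclusion of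
the sets `L(a)` (`QATS.Approximable.le_iff`), and application is then monotone in its argument
(`QATS.Approximable.isATS`).

*Parallel convergence gives expressiveness.*  With parallel convergence `P` and convergence testing
`C`, the fixed point `J a b = C (P a b) (λx. J (a x) (b x))` is a binary join for the bisimulation
preorder (`LTS.exists_isJoin`).  Joins interpret conjunction, and so induction on `φ` yields both a
least satisfier of `φ` and a test that converges on exactly the satisfiers of `φ`
(`LTS.exists_least_and_test`).  That the least satisfier satisfies nothing but the consequences of
`φ` is an induction on the nesting of arrows (`QATS.entails_of_sat`), because the value of the least
satisfier at `y` is again a least satisfier, of the formula `QATS.after φ y`.  Tests turn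
approximability, which concerns convergence, into a statement about all formulae: if `a ⇓` and
`a b ⊨ ψ`, then `a ⊨ (φ → ψ)_⊥` for some `φ` with `b ⊨ φ` (`LTS.exists_sat_arrow`).

*The domain.*  Elements of the finite approximants of `D` are least satisfiers of formulae
(`exists_fml_emb`), which gives that the order of `D` is logical inclusion and, with continuity, that
`D` is approximable.  As `P` and `C` exist in `D`, the general results apply to `D` itself: every
formula has a least satisfier in `D`, every compact element is one, and every filter of formulae is
`L(d)` for some `d`.  Hence every lts has a unique map to `D` that preserves and reflects
satisfaction.

Given expressiveness and tests, completeness of the program logic follows by evaluating terms in the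
environment of least satisfiers, and the canonical map to `D` preserves application by
`LTS.exists_sat_arrow`, hence also `k` and `s`, as elements of `D` are determined by their action on
compact arguments.  An embedding whose image contains the compact elements transfers theories, since
a conditional formula that fails in `D` fails at a compact environment
(`LTS.fullyAbstract_of_embedding`).  Conversely, expressiveness, completeness and full abstraction
each provide an element that converges when one of two arguments does but not on a pair of divergent
arguments; guarding the arguments with `C` makes it a parallel convergence operator
(`LTS.parConvDefinable_of`).

For the language with the constant `P`, the denotational semantics in `D` is adequate
(`PLam.sat_inst`, by a logical relation given by inclusion of the sets `L`).  Adequacy makes the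
denotation a homomorphism that reflects convergence, so that approximability, the laws of an lts,
convergence testing and sensibility are all inherited from `D`.
-/

namespace LazyLambda

/-! ### Bisimulation in applicative transition systems -/

namespace QATS

variable {A : Type*} {𝒜 : QATS A} {a b c : A}

theorem div_iff : 𝒜.Div a ↔ 𝒜.ev a = none := by
  simp [Div, Conv, Option.eq_none_iff_forall_ne_some]

theorem app_of_ev {f : A → A} (h : 𝒜.ev a = some f) (b : A) : 𝒜.app a b = f b := by
  simp [app, h]

theorem Div.app (h : 𝒜.Div a) (b : A) : 𝒜.app a b = a := by
  simp [QATS.app, div_iff.1 h]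

theorem Div.foldl (h : 𝒜.Div a) (bs : List A) : bs.foldl 𝒜.app a = a := by
  induction bs with
  | nil => rfl
  | cons b bs ih => rw [List.foldl_cons, h.app, ih]

theorem Conv.of_app (h : 𝒜.Conv (𝒜.app a b)) : 𝒜.Conv a := by
  by_contra ha
  exact ha (Div.app ha b ▸ h)

theorem Conv.of_foldl {bs : List A} (h : 𝒜.Conv (bs.foldl 𝒜.app a)) : 𝒜.Conv a := by
  by_contra ha
  exact ha (Div.foldl ha bs ▸ h)

theorem Div.app' (h : 𝒜.Div a) (b : A) : 𝒜.Div (𝒜.app a b) := fun h' => h h'.of_app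

/-- Applicative bisimulation is observational: it compares convergence under all sequences of
arguments. -/
theorem le_iff_foldl :
    𝒜.Le a b ↔ ∀ cs : List A, 𝒜.Conv (cs.foldl 𝒜.app a) → 𝒜.Conv (cs.foldl 𝒜.app b) := by
  constructor
  · rintro ⟨R, hR, hab⟩ cs
    induction cs generalizing a b with
    | nil =>
      rintro ⟨f, hf⟩
      obtain ⟨g, hg, -⟩ := hR a b hab f hf
      exact ⟨g, hg⟩
    | cons c cs ih =>
      intro h
      obtain ⟨f, hf⟩ := Conv.of_foldl (bs := c :: cs) h
      obtain ⟨g, hg, hfg⟩ := hR a b hab f hf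
      rw [List.foldl_cons, app_of_ev hf] at h
      rw [List.foldl_cons, app_of_ev hg]
      exact ih (hfg c) h
  · intro h
    refine ⟨fun a b => ∀ cs : List A, 𝒜.Conv (cs.foldl 𝒜.app a) → 𝒜.Conv (cs.foldl 𝒜.app b),
      fun a b h f hf => ?_, h⟩
    obtain ⟨g, hg⟩ : 𝒜.Conv b := h [] ⟨f, hf⟩
    refine ⟨g, hg, fun c cs hc => ?_⟩
    have := h (c :: cs)
    rw [List.foldl_cons, List.foldl_cons, app_of_ev hf, app_of_ev hg] at this
    exact this hc

theorem Le.refl (a : A) : 𝒜.Le a a := le_iff_foldl.2 fun _ h => h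

theorem Le.trans (h : 𝒜.Le a b) (h' : 𝒜.Le b c) : 𝒜.Le a c :=
  le_iff_foldl.2 fun cs hc => le_iff_foldl.1 h' cs (le_iff_foldl.1 h cs hc)

theorem Le.conv (h : 𝒜.Le a b) (ha : 𝒜.Conv a) : 𝒜.Conv b := le_iff_foldl.1 h [] ha

theorem Le.app_left (h : 𝒜.Le a b) (c : A) : 𝒜.Le (𝒜.app a c) (𝒜.app b c) :=
  le_iff_foldl.2 fun cs hc => le_iff_foldl.1 h (c :: cs) hc

theorem Div.le (h : 𝒜.Div a) (b : A) : 𝒜.Le a b :=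
  le_iff_foldl.2 fun _ hc => absurd hc.of_foldl h

theorem le_of_app (h : 𝒜.Conv a → 𝒜.Conv b ∧ ∀ c, 𝒜.Le (𝒜.app a c) (𝒜.app b c)) : 𝒜.Le a b := by
  refine le_iff_foldl.2 fun cs hc => ?_
  cases cs with
  | nil => exact (h hc).1
  | cons c cs =>
    have ha : 𝒜.Conv a := Conv.of_foldl hc
    exact le_iff_foldl.1 ((h ha).2 c) cs hc

theorem Equiv.refl (a : A) : 𝒜.Equiv a a := ⟨Le.refl a, Le.refl a⟩

theorem Equiv.trans (h : 𝒜.Equiv a b) (h' : 𝒜.Equiv b c) : 𝒜.Equiv a c :=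
  ⟨h.1.trans h'.1, h'.2.trans h.2⟩

theorem Equiv.conv_iff (h : 𝒜.Equiv a b) : 𝒜.Conv a ↔ 𝒜.Conv b := ⟨h.1.conv, h.2.conv⟩

theorem Equiv.foldl_conv_iff (h : 𝒜.Equiv a b) (cs : List A) :
    𝒜.Conv (cs.foldl 𝒜.app a) ↔ 𝒜.Conv (cs.foldl 𝒜.app b) :=
  ⟨le_iff_foldl.1 h.1 cs, le_iff_foldl.1 h.2 cs⟩

/-! ### Satisfaction of formulae -/

theorem sat_arrow {φ ψ : Fml} :
    𝒜.Sat a (.arrow φ ψ) ↔ 𝒜.Conv a ∧ ∀ b, 𝒜.Sat b φ → 𝒜.Sat (𝒜.app a b) ψ := by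
  constructor
  · rintro ⟨f, hf, h⟩
    exact ⟨⟨f, hf⟩, fun b hb => by rw [app_of_ev hf]; exact h b hb⟩
  · rintro ⟨⟨f, hf⟩, h⟩
    exact ⟨f, hf, fun b hb => by rw [← app_of_ev hf]; exact h b hb⟩

theorem sat_lam : 𝒜.Sat a .lam ↔ 𝒜.Conv a :=
  sat_arrow.trans ⟨fun h => h.1, fun h => ⟨h, fun _ _ => trivial⟩⟩

theorem Sat.mono (h : 𝒜.Le a b) {φ : Fml} (ha : 𝒜.Sat a φ) : 𝒜.Sat b φ := by
  induction φ generalizing a b with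
  | top => trivial
  | and φ ψ ih₁ ih₂ => exact ⟨ih₁ h ha.1, ih₂ h ha.2⟩
  | arrow φ ψ _ ih =>
    rw [sat_arrow] at ha ⊢
    exact ⟨h.conv ha.1, fun c hc => ih (h.app_left c) (ha.2 c hc)⟩

theorem Equiv.sat_iff (h : 𝒜.Equiv a b) {φ : Fml} : 𝒜.Sat a φ ↔ 𝒜.Sat b φ :=
  ⟨Sat.mono h.1, Sat.mono h.2⟩

/-- Derivable inequalities of `ℒ` are valid in every quasi-ats. -/
theorem Sat.entails {φ ψ : Fml} (h : Fml.Entails φ ψ) (ha : 𝒜.Sat a φ) : 𝒜.Sat a ψ := by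
  induction h generalizing a with
  | refl => exact ha
  | trans _ _ ih₁ ih₂ => exact ih₂ (ih₁ ha)
  | le_top => trivial
  | and_intro _ _ ih₁ ih₂ => exact ⟨ih₁ ha, ih₂ ha⟩
  | and_left => exact ha.1
  | and_right => exact ha.2
  | arrow_mono _ _ ih₁ ih₂ =>
    obtain ⟨f, hf, h⟩ := ha
    exact ⟨f, hf, fun b hb => ih₂ (h b (ih₁ hb))⟩
  | arrow_and =>
    obtain ⟨f, hf, h⟩ := ha
    exact ⟨⟨f, hf, fun b hb => (h b hb).1⟩, ⟨f, hf, fun b hb => (h b hb).2⟩⟩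
  | and_arrow =>
    rw [Sat, sat_arrow, sat_arrow] at ha
    exact sat_arrow.2 ⟨ha.1.1, fun b hb => ⟨ha.1.2 b hb, ha.2.2 b hb⟩⟩
  | arrow_top =>
    obtain ⟨f, hf, h⟩ := ha
    exact ⟨f, hf, fun _ _ => trivial⟩

theorem Sat.foldl {bs : List A} {φs : List Fml} {ψ : Fml} (h : List.Forall₂ 𝒜.Sat bs φs)
    (ha : 𝒜.Sat a (φs.foldr Fml.arrow ψ)) : 𝒜.Sat (bs.foldl 𝒜.app a) ψ := by
  induction h generalizing a with
  | nil => exact ha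
  | cons hb _ ih => exact ih ((sat_arrow.1 ha).2 _ hb)

/-- In an approximable quasi-ats, the bisimulation preorder is the logical preorder. -/
theorem Approximable.le_iff (h : 𝒜.Approximable) :
    𝒜.Le a b ↔ ∀ φ, 𝒜.Sat a φ → 𝒜.Sat b φ := by
  refine ⟨fun hab φ => Sat.mono hab, fun hab => le_iff_foldl.2 fun cs hc => ?_⟩
  obtain ⟨φs, hcs, ha⟩ := h a cs hc
  exact sat_lam.1 ((hab _ ha).foldl hcs)

/-- Approximability makes application monotone in the argument. -/
theorem Approximable.isATS (h : 𝒜.Approximable) : 𝒜.IsATS := by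
  intro a b c f hf hbc
  refine le_iff_foldl.2 fun cs hc => ?_
  rw [← app_of_ev hf] at hc ⊢
  obtain ⟨φs, hcs, ha⟩ := h a (b :: cs) hc
  cases hcs with
  | cons hb hcs =>
    exact sat_lam.1 (ha.foldl (bs := c :: cs) (.cons (hb.mono hbc) hcs))

end QATS

/-! ### Combinatory completeness of lambda transition systems -/

namespace CL

variable {A : Type*} (𝒜 : QATS A)

theorem eval_congr {ρ ρ' : ℕ → A} (M : CL A) (h : ∀ x ∈ M.fv, ρ x = ρ' x) :
    eval 𝒜 ρ M = eval 𝒜 ρ' M := by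
  induction M with
  | var x => exact h x (by simp [fv])
  | const a => rfl
  | app M N ih₁ ih₂ =>
    simp only [eval]
    rw [ih₁ fun x hx => h x (by simp [fv, hx]), ih₂ fun x hx => h x (by simp [fv, hx])]

theorem fv_bracket (k s : A) (x : ℕ) (M : CL A) : (bracket k s x M).fv = M.fv \ {x} := by
  induction M with
  | var y =>
    by_cases h : y = x
    · simp [bracket, h, fv]
    · simp [bracket, h, fv, Finset.sdiff_singleton_eq_erase, Ne.symm h]
  | const a => simp [bracket, fv]
  | app M N ih₁ ih₂ =>
    rw [bracket]
    split_ifs with h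
    · simp only [fv, ih₁, ih₂, Finset.union_sdiff_distrib, Finset.empty_union]
    · rw [Finset.sdiff_singleton_eq_erase, Finset.erase_eq_of_notMem h]
      simp only [fv, Finset.empty_union]

end CL

namespace LTS

variable {A : Type*} {𝒜 : LTS A}

namespace IsLTS

variable (h : 𝒜.IsLTS)
include h

theorem app_le_app {a a' b b' : A} (ha : 𝒜.Le a a') (hb : 𝒜.Le b b') :
    𝒜.Le (𝒜.app a b) (𝒜.app a' b') := by
  refine (ha.app_left b).trans ?_
  by_cases h' : 𝒜.Conv a'
  · obtain ⟨f, hf⟩ := h'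
    rw [QATS.app_of_ev hf, QATS.app_of_ev hf]
    exact h.isATS a' b b' f hf hb
  · exact QATS.Div.le (QATS.Div.app' h' b) _

theorem app_congr {a a' b b' : A} (ha : 𝒜.Equiv a a') (hb : 𝒜.Equiv b b') :
    𝒜.Equiv (𝒜.app a b) (𝒜.app a' b') :=
  ⟨h.app_le_app ha.1 hb.1, h.app_le_app ha.2 hb.2⟩

theorem i_app (a : A) : 𝒜.Equiv (𝒜.app 𝒜.i a) a := (h.s_app _ _ _).trans (h.k_app _ _)

theorem i_conv : 𝒜.Conv 𝒜.i := h.s_conv₂ _ _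

theorem conv_bracket (ρ : ℕ → A) (x : ℕ) (M : CL A) :
    𝒜.Conv (CL.eval 𝒜.toQATS ρ (CL.bracket 𝒜.k 𝒜.s x M)) := by
  cases M with
  | var y =>
    by_cases hy : y = x
    · simp only [CL.bracket, hy, if_true]; exact h.s_conv₂ _ _
    · simp only [CL.bracket, hy, if_false]; exact h.k_conv₁ _
  | const a => exact h.k_conv₁ _
  | app M N =>
    by_cases hx : x ∈ CL.fv (.app M N)
    · simp only [CL.bracket, hx, if_true]; exact h.s_conv₂ _ _
    · simp only [CL.bracket, hx, if_false]; exact h.k_conv₁ _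

/-- Bracket abstraction satisfies the law `(β)`. -/
theorem bracket_app (ρ : ℕ → A) (x : ℕ) (M : CL A) (a : A) :
    𝒜.Equiv (𝒜.app (CL.eval 𝒜.toQATS ρ (CL.bracket 𝒜.k 𝒜.s x M)) a)
      (CL.eval 𝒜.toQATS (Function.update ρ x a) M) := by
  induction M with
  | var y =>
    by_cases hy : y = x
    · subst hy
      simp only [CL.bracket, if_true, CL.eval, Function.update_self]
      exact h.i_app a
    · simp only [CL.bracket, hy, if_false, CL.eval, Function.update_of_ne hy]
      exact h.k_app _ _
  | const b => exact h.k_app _ _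
  | app M N ih₁ ih₂ =>
    by_cases hx : x ∈ CL.fv (.app M N)
    · simp only [CL.bracket, hx, if_true]
      exact (h.s_app _ _ _).trans (h.app_congr ih₁ ih₂)
    · simp only [CL.bracket, hx, if_false]
      rw [CL.eval_congr 𝒜.toQATS (ρ := Function.update ρ x a) (ρ' := ρ) (.app M N) fun y hy =>
        Function.update_of_ne (ne_of_mem_of_not_mem hy hx) _ _]
      exact h.k_app _ _

/-- Every polynomial in one variable is represented by a convergent element. -/
theorem exists_abs (ρ : ℕ → A) (x : ℕ) (M : CL A) :
    ∃ u, 𝒜.Conv u ∧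
      ∀ a, 𝒜.Equiv (𝒜.app u a) (CL.eval 𝒜.toQATS (Function.update ρ x a) M) :=
  ⟨_, h.conv_bracket ρ x M, h.bracket_app ρ x M⟩

theorem interp_lam_conv (ρ : ℕ → A) (x : ℕ) (M : PureLam) : 𝒜.Conv (𝒜.interp ρ (.lam x M)) :=
  h.conv_bracket _ _ _

theorem interp_lam_app (ρ : ℕ → A) (x : ℕ) (M : PureLam) (a : A) :
    𝒜.Equiv (𝒜.app (𝒜.interp ρ (.lam x M)) a) (𝒜.interp (Function.update ρ x a) M) :=
  h.bracket_app _ _ _ _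

/-- The program logic is sound in every lts. -/
theorem models_of_derives {M : PureLam} {Γ : ℕ → Fml} {φ : Fml} (hM : Derives M Γ φ) :
    𝒜.Models M Γ φ := by
  induction hM with
  | top => exact fun _ _ => trivial
  | and _ _ ih₁ ih₂ => exact fun ρ hρ => ⟨ih₁ ρ hρ, ih₂ ρ hρ⟩
  | leq hΓ _ hφ ih => exact fun ρ hρ => (ih ρ fun x => (hρ x).entails (hΓ x)).entails hφ
  | var x Γ φ =>
    intro ρ hρ
    have := hρ x
    rwa [Function.update_self] at this
  | @abs M Γ x φ ψ _ ih =>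
    intro ρ hρ
    refine QATS.sat_arrow.2 ⟨h.interp_lam_conv ρ x M, fun b hb => ?_⟩
    refine (h.interp_lam_app ρ x M b).sat_iff.2 (ih _ fun y => ?_)
    by_cases hy : y = x
    · subst hy; simpa using hb
    · simpa [hy] using hρ y
  | app _ _ ih₁ ih₂ => exact fun ρ hρ => (QATS.sat_arrow.1 (ih₁ ρ hρ)).2 _ (ih₂ ρ hρ)

end IsLTS

end LTS

/-! ### Deriving inequalities from least satisfiers -/

namespace Fml

/-- The depth of nesting of `(· → ·)_⊥`. -/
def rank : Fml → ℕ
  | top => 0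
  | and φ ψ => max φ.rank ψ.rank
  | arrow φ ψ => max φ.rank ψ.rank + 1

end Fml

namespace QATS

variable {A : Type*} (𝒜 : QATS A)

open Classical in
/-- The formula that `𝒜` guarantees for `a · y` when `a ⊨ φ`: the conjunction of all `ψ₂` such that
`(ψ₁ → ψ₂)_⊥` is a conjunct of `φ` with `y ⊨ ψ₁`. -/
noncomputable def after : Fml → A → Fml
  | .top, _ => .top
  | .and φ ψ, y => .and (after φ y) (after ψ y)
  | .arrow φ ψ, y => if 𝒜.Sat y φ then ψ else .top

variable {𝒜}

theorem rank_after_le (φ : Fml) (y : A) : (𝒜.after φ y).rank ≤ φ.rank - 1 := by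
  induction φ with
  | top => simp [after, Fml.rank]
  | and φ ψ ih₁ ih₂ => simp only [after, Fml.rank]; omega
  | arrow φ ψ => unfold after; split_ifs <;> simp [Fml.rank]

/-- `φ` derivably sends `χ` to `after φ y`, provided that it converges and that `χ` derivably implies
the formulae of smaller rank satisfied by `y`.  The conjunct `λ` takes care of formulae equivalent
to `t`. -/
theorem entails_arrow_after {n : ℕ} {χ : Fml} {y : A}
    (h : ∀ θ : Fml, θ.rank ≤ n → 𝒜.Sat y θ → Fml.Entails χ θ) (φ : Fml) (hφ : φ.rank ≤ n + 1) :
    Fml.Entails (.and .lam φ) (.arrow χ (𝒜.after φ y)) := by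
  have htop : Fml.Entails .lam (.arrow χ .top) := .arrow_mono (.le_top _) (.refl _)
  induction φ with
  | top => exact (Fml.Entails.and_left _ _).trans htop
  | and φ ψ ih₁ ih₂ =>
    simp only [Fml.rank] at hφ
    refine .trans (.and_intro (.trans ?_ (ih₁ (by omega))) (.trans ?_ (ih₂ (by omega))))
      (.and_arrow _ _ _)
    · exact .and_intro (.and_left _ _) ((Fml.Entails.and_right _ _).trans (.and_left _ _))
    · exact .and_intro (.and_left _ _) ((Fml.Entails.and_right _ _).trans (.and_right _ _))
  | arrow φ ψ =>
    simp only [Fml.rank] at hφ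
    unfold after
    split_ifs with hy
    · exact (Fml.Entails.and_right _ _).trans (.arrow_mono (h φ (by omega) hy) (.refl _))
    · exact (Fml.Entails.and_left _ _).trans htop

/-- If every formula `φ` has a satisfier `e φ` that does no more than `φ` forces it to do, then
`e φ` satisfies only the consequences of `φ`. -/
theorem entails_of_sat (e : Fml → A) (h₁ : ∀ φ, 𝒜.Sat (e φ) φ)
    (h₂ : ∀ φ, 𝒜.Conv (e φ) → Fml.Entails φ .lam)
    (h₃ : ∀ φ y, 𝒜.Le (𝒜.app (e φ) y) (e (𝒜.after φ y))) {φ ψ : Fml} (h : 𝒜.Sat (e φ) ψ) :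
    Fml.Entails φ ψ := by
  suffices H : ∀ n, ∀ φ ψ : Fml, φ.rank ≤ n → ψ.rank ≤ n → 𝒜.Sat (e φ) ψ → Fml.Entails φ ψ from
    H (max φ.rank ψ.rank) φ ψ (le_max_left _ _) (le_max_right _ _) h
  intro n
  induction n with
  | zero =>
    intro φ ψ _ hψ h
    induction ψ with
    | top => exact .le_top _
    | and ψ₁ ψ₂ ih₁ ih₂ =>
      simp only [Fml.rank] at hψ
      exact .and_intro (ih₁ (by omega) h.1) (ih₂ (by omega) h.2)
    | arrow => simp [Fml.rank] at hψ
  | succ n ih =>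
    intro φ ψ hφ hψ h
    induction ψ with
    | top => exact .le_top _
    | and ψ₁ ψ₂ ih₁ ih₂ =>
      simp only [Fml.rank] at hψ
      exact .and_intro (ih₁ (by omega) h.1) (ih₂ (by omega) h.2)
    | arrow ψ₁ ψ₂ =>
      simp only [Fml.rank] at hψ
      rw [sat_arrow] at h
      have h4 := (h.2 (e ψ₁) (h₁ ψ₁)).mono (h₃ φ (e ψ₁))
      have h5 := ih _ ψ₂ ((rank_after_le φ (e ψ₁)).trans (by omega)) (by omega) h4
      refine .trans (.and_intro (h₂ φ h.1) (.refl φ)) (.trans ?_ (.arrow_mono (.refl ψ₁) h5))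
      exact entails_arrow_after (n := n) (fun θ hθ => ih ψ₁ θ (by omega) hθ) φ hφ

end QATS

/-! ### Joins, least satisfiers and tests from parallel convergence -/

namespace QATS

variable {A : Type*} (𝒜 : QATS A)

/-- Every formula has a test: an element that converges on exactly its satisfiers. -/
def Testable : Prop := ∀ φ, ∃ T, ∀ x, 𝒜.Conv (𝒜.app T x) ↔ 𝒜.Sat x φ

/-- `j` is a join operation for the bisimulation preorder that commutes with application. -/
structure IsJoin (j : A → A → A) : Prop where
  conv_iff : ∀ a b, 𝒜.Conv (j a b) ↔ 𝒜.Conv a ∨ 𝒜.Conv b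
  app : ∀ a b, 𝒜.Conv (j a b) → ∀ x, 𝒜.Equiv (𝒜.app (j a b) x) (j (𝒜.app a x) (𝒜.app b x))

variable {𝒜}

namespace IsJoin

variable {j : A → A → A} (h : 𝒜.IsJoin j)
include h

theorem foldl_conv_iff (a b : A) (xs : List A) :
    𝒜.Conv (xs.foldl 𝒜.app (j a b)) ↔ 𝒜.Conv (xs.foldl 𝒜.app a) ∨ 𝒜.Conv (xs.foldl 𝒜.app b) := by
  induction xs generalizing a b with
  | nil => exact h.conv_iff a b
  | cons x xs ih =>
    by_cases hc : 𝒜.Conv (j a b)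
    · exact ((h.app a b hc x).foldl_conv_iff xs).trans (ih _ _)
    · have hab := mt (h.conv_iff a b).2 hc
      exact iff_of_false (fun h' => hc h'.of_foldl)
        (fun h' => hab (h'.imp (fun k => k.of_foldl) fun k => k.of_foldl))

theorem le_left (a b : A) : 𝒜.Le a (j a b) :=
  le_iff_foldl.2 fun xs hx => (h.foldl_conv_iff a b xs).2 (.inl hx)

theorem le_right (a b : A) : 𝒜.Le b (j a b) :=
  le_iff_foldl.2 fun xs hx => (h.foldl_conv_iff a b xs).2 (.inr hx)

theorem le {a b c : A} (ha : 𝒜.Le a c) (hb : 𝒜.Le b c) : 𝒜.Le (j a b) c :=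
  le_iff_foldl.2 fun xs hx => ((h.foldl_conv_iff a b xs).1 hx).elim (le_iff_foldl.1 ha xs)
    (le_iff_foldl.1 hb xs)

theorem app_le {a b y c : A} (ha : 𝒜.Le (𝒜.app a y) c) (hb : 𝒜.Le (𝒜.app b y) c) :
    𝒜.Le (𝒜.app (j a b) y) c :=
  le_iff_foldl.2 fun xs hx => ((h.foldl_conv_iff a b (y :: xs)).1 hx).elim (le_iff_foldl.1 ha xs)
    (le_iff_foldl.1 hb xs)

end IsJoin

end QATS

namespace LTS

variable {A : Type*} {𝒜 : LTS A}

/-- `c` is a convergence test. -/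
structure IsConvTest (𝒜 : LTS A) (c : A) : Prop where
  conv : 𝒜.Conv c
  div : ∀ x, 𝒜.Div x → 𝒜.Div (𝒜.app c x)
  equiv : ∀ x, 𝒜.Conv x → 𝒜.Equiv (𝒜.app c x) 𝒜.i

theorem ConvTestDefinable.exists (h : 𝒜.ConvTestDefinable) : ∃ c, 𝒜.IsConvTest c :=
  let ⟨c, h₁, h₂, h₃⟩ := h
  ⟨c, h₁, h₂, h₃⟩

/-- `c x y` is `y` guarded by the convergence of `x`. -/
theorem IsConvTest.app_equiv (h : 𝒜.IsLTS) {c : A} (hc : 𝒜.IsConvTest c) {x : A} (hx : 𝒜.Conv x)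
    (y : A) : 𝒜.Equiv (𝒜.app (𝒜.app c x) y) y :=
  (h.app_congr (hc.equiv x hx) (.refl y)).trans (h.i_app y)

theorem IsConvTest.app_div {c : A} (hc : 𝒜.IsConvTest c) {x : A} (hx : 𝒜.Div x) (y : A) :
    𝒜.Div (𝒜.app (𝒜.app c x) y) := (hc.div x hx).app' y

theorem IsConvTest.app_conv_iff (h : 𝒜.IsLTS) {c : A} (hc : 𝒜.IsConvTest c) (x y : A) :
    𝒜.Conv (𝒜.app (𝒜.app c x) y) ↔ 𝒜.Conv x ∧ 𝒜.Conv y := by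
  by_cases hx : 𝒜.Conv x
  · simp [(hc.app_equiv h hx y).conv_iff, hx]
  · exact iff_of_false (hc.app_div hx y) fun h' => hx h'.1

/-- A join operation is obtained as the fixed point `J a b = C (P a b) (λx. J (a x) (b x))`; the
recursion is carried out by self-application. -/
theorem exists_isJoin (h : 𝒜.IsLTS) (hC : 𝒜.ConvTestDefinable) (hP : 𝒜.ParConvDefinable) :
    ∃ j, 𝒜.IsJoin j := by
  obtain ⟨c, hc⟩ := hC.exists
  obtain ⟨p, -, -, hp₁, hp₂, hp₃⟩ := hP
  have hp : ∀ a b, 𝒜.Conv (𝒜.app (𝒜.app p a) b) ↔ 𝒜.Conv a ∨ 𝒜.Conv b := fun a b =>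
    ⟨fun h' => by
      by_contra hab
      rw [not_or] at hab
      exact hp₃ a b hab.1 hab.2 h', fun h' => h'.elim (hp₁ a b) (hp₂ a b)⟩
  -- the body `λx. w w (a x) (b x)`, with `w`, `a`, `b`, `x` the variables `0`, `1`, `2`, `3`
  let B : CL A := CL.bracket 𝒜.k 𝒜.s 3
    (.app (.app (.app (.var 0) (.var 0)) (.app (.var 1) (.var 3))) (.app (.var 2) (.var 3)))
  let W₂ : CL A := CL.bracket 𝒜.k 𝒜.s 2
    (.app (.app (.const c) (.app (.app (.const p) (.var 1)) (.var 2))) B)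
  let W₁ : CL A := CL.bracket 𝒜.k 𝒜.s 1 W₂
  obtain ⟨w, -, hw⟩ := h.exists_abs (fun _ => 𝒜.k) 0 W₁
  let r : A → A → ℕ → A := fun a b => Function.update (Function.update (Function.update
    (fun _ => 𝒜.k) 0 w) 1 a) 2 b
  let j : A → A → A := fun a b => 𝒜.app (𝒜.app (𝒜.app w w) a) b
  have hj : ∀ a b, 𝒜.Equiv (j a b) (𝒜.app (𝒜.app c (𝒜.app (𝒜.app p a) b))
      (CL.eval 𝒜.toQATS (r a b) B)) := fun a b =>
    (h.app_congr ((h.app_congr (hw w) (.refl a)).trans (h.bracket_app _ _ _ _)) (.refl b)).trans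
      (h.bracket_app _ _ _ _)
  have hB : ∀ a b x, 𝒜.Equiv (𝒜.app (CL.eval 𝒜.toQATS (r a b) B) x)
      (j (𝒜.app a x) (𝒜.app b x)) := fun a b x => h.bracket_app _ _ _ _
  have hconv : ∀ a b, 𝒜.Conv (j a b) ↔ 𝒜.Conv a ∨ 𝒜.Conv b := fun a b => by
    rw [(hj a b).conv_iff, hc.app_conv_iff h, hp]
    exact and_iff_left (h.conv_bracket _ _ _)
  refine ⟨j, hconv, fun a b hab x => ?_⟩
  refine (h.app_congr ((hj a b).trans (hc.app_equiv h ?_ _)) (.refl x)).trans (hB a b x)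
  exact (hp a b).2 ((hconv a b).1 hab)

/-- In an lts with a divergent element, convergence testing and parallel convergence, every formula
`φ` has a least satisfier, which does no more than `φ` forces it to do, and a test.  The two are
constructed together, since the test for `(φ → ψ)_⊥` applies its argument to the least satisfier of
`φ`, and the least satisfier of `(φ → ψ)_⊥` tests its argument for `φ`. -/
theorem exists_least_and_test (h : 𝒜.IsLTS) (hC : 𝒜.ConvTestDefinable) (hP : 𝒜.ParConvDefinable)
    {o : A} (ho : 𝒜.Div o) (φ : Fml) :
    ∃ a T, 𝒜.Sat a φ ∧ (∀ y, 𝒜.Sat y φ → 𝒜.Le a y) ∧ (𝒜.Conv a → Fml.Entails φ .lam) ∧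
      (∀ y w, 𝒜.Sat w (𝒜.after φ y) → 𝒜.Le (𝒜.app a y) w) ∧
      ∀ x, 𝒜.Conv (𝒜.app T x) ↔ 𝒜.Sat x φ := by
  obtain ⟨j, hj⟩ := exists_isJoin h hC hP
  obtain ⟨c, hc⟩ := hC.exists
  let ρ : ℕ → A := fun _ => 𝒜.k
  induction φ with
  | top =>
    refine ⟨o, 𝒜.app 𝒜.k 𝒜.k, trivial, fun y _ => ho.le y, fun h' => absurd h' ho,
      fun y w _ => (ho.app' y).le w, fun x => iff_of_true ?_ trivial⟩
    exact (h.k_app _ _).conv_iff.2 h.k_conv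
  | and φ ψ ih₁ ih₂ =>
    obtain ⟨a₁, T₁, s₁, l₁, c₁, f₁, t₁⟩ := ih₁
    obtain ⟨a₂, T₂, s₂, l₂, c₂, f₂, t₂⟩ := ih₂
    obtain ⟨T, -, hT⟩ := h.exists_abs ρ 0
      (.app (.app (.const c) (.app (.const T₁) (.var 0))) (.app (.const T₂) (.var 0)))
    refine ⟨j a₁ a₂, T, ⟨s₁.mono (hj.le_left _ _), s₂.mono (hj.le_right _ _)⟩,
      fun y hy => hj.le (l₁ y hy.1) (l₂ y hy.2), fun h' => ?_,
      fun y w hw => hj.app_le (f₁ y w hw.1) (f₂ y w hw.2), fun x => ?_⟩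
    · rcases (hj.conv_iff _ _).1 h' with h' | h'
      · exact (Fml.Entails.and_left _ _).trans (c₁ h')
      · exact (Fml.Entails.and_right _ _).trans (c₂ h')
    · rw [(hT x).conv_iff]
      exact (hc.app_conv_iff h _ _).trans (and_congr (t₁ x) (t₂ x))
  | arrow φ ψ ih₁ ih₂ =>
    obtain ⟨a₁, T₁, s₁, l₁, c₁, f₁, t₁⟩ := ih₁
    obtain ⟨a₂, T₂, s₂, l₂, c₂, f₂, t₂⟩ := ih₂
    obtain ⟨T, -, hT⟩ := h.exists_abs ρ 0 (.app (.app (.const c) (.var 0))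
      (.app (.const T₂) (.app (.var 0) (.const a₁))))
    obtain ⟨a, ha, hay⟩ := h.exists_abs ρ 0
      (.app (.app (.const c) (.app (.const T₁) (.var 0))) (.const a₂))
    have hpos : ∀ y, 𝒜.Sat y φ → 𝒜.Equiv (𝒜.app a y) a₂ := fun y hy =>
      (hay y).trans (hc.app_equiv h ((t₁ y).2 hy) a₂)
    have hneg : ∀ y, ¬ 𝒜.Sat y φ → 𝒜.Div (𝒜.app a y) := fun y hy h' =>
      hc.app_div (mt (t₁ y).1 hy) a₂ ((hay y).conv_iff.1 h')
    refine ⟨a, T, QATS.sat_arrow.2 ⟨ha, fun y hy => (hpos y hy).sat_iff.2 s₂⟩,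
      fun z hz => QATS.le_of_app fun _ => ?_,
      fun _ => (Fml.Entails.arrow_mono (.refl _) (.le_top _)).trans (.arrow_top _),
      fun y w hw => ?_, fun x => ?_⟩
    · rw [QATS.sat_arrow] at hz
      refine ⟨hz.1, fun y => ?_⟩
      by_cases hy : 𝒜.Sat y φ
      · exact (hpos y hy).1.trans (l₂ _ (hz.2 y hy))
      · exact (hneg y hy).le _
    · by_cases hy : 𝒜.Sat y φ
      · exact (hpos y hy).1.trans (l₂ w (by simpa [QATS.after, hy] using hw))
      · exact (hneg y hy).le _
    · rw [(hT x).conv_iff]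
      refine (hc.app_conv_iff h _ _).trans ?_
      rw [QATS.sat_arrow]
      refine and_congr_right fun hx => (t₂ _).trans ⟨fun h' b hb => ?_, fun h' => h' a₁ s₁⟩
      exact h'.mono (h.app_le_app (.refl x) (l₁ b hb))

theorem expressive_of_parConv (h : 𝒜.IsLTS) (hC : 𝒜.ConvTestDefinable) (hP : 𝒜.ParConvDefinable)
    {o : A} (ho : 𝒜.Div o) : 𝒜.Expressive := by
  choose e T h₁ _ h₂ h₃ _ using exists_least_and_test h hC hP ho
  exact fun φ => ⟨e φ, fun ψ => ⟨QATS.entails_of_sat e h₁ h₂ fun φ y => h₃ φ y _ (h₁ _),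
    (h₁ φ).entails⟩⟩

theorem testable_of_parConv (h : 𝒜.IsLTS) (hC : 𝒜.ConvTestDefinable) (hP : 𝒜.ParConvDefinable)
    {o : A} (ho : 𝒜.Div o) : 𝒜.Testable := fun φ =>
  let ⟨_, T, _, _, _, _, hT⟩ := exists_least_and_test h hC hP ho φ
  ⟨T, hT⟩

/-- Satisfaction by an application is witnessed by a formula for the argument: approximability
extends from convergence to arbitrary formulae by means of tests. -/
theorem exists_sat_arrow (h : 𝒜.IsLTS) (hA : 𝒜.Approximable) (hT : 𝒜.Testable) {a b : A} {ψ : Fml}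
    (ha : 𝒜.Conv a) (hab : 𝒜.Sat (𝒜.app a b) ψ) :
    ∃ φ, 𝒜.Sat a (.arrow φ ψ) ∧ 𝒜.Sat b φ := by
  obtain ⟨T, hT⟩ := hT ψ
  obtain ⟨u, -, hu⟩ := h.exists_abs (fun _ => 𝒜.k) 0
    (.app (.const T) (.app (.const a) (.var 0)))
  have hu' : ∀ y, 𝒜.Conv (𝒜.app u y) ↔ 𝒜.Sat (𝒜.app a y) ψ := fun y =>
    (hu y).conv_iff.trans (hT _)
  obtain ⟨φs, hφ, hs⟩ := hA u [b] ((hu' b).2 hab)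
  cases hφ with
  | cons hb hnil =>
    cases hnil
    exact ⟨_, QATS.sat_arrow.2 ⟨ha, fun y hy =>
      (hu' y).1 (QATS.sat_lam.1 ((QATS.sat_arrow.1 hs).2 y hy))⟩, hb⟩

/-- Parallel convergence is definable as soon as some element `x` separates, with arguments `y⇑` and
`z`, the pairs `(y, z)` and `(z, y)` from `(y, y)`. -/
theorem parConvDefinable_of (h : 𝒜.IsLTS) (hC : 𝒜.ConvTestDefinable) {x y z : A} (hy : 𝒜.Div y)
    (hzy : 𝒜.Conv (𝒜.app (𝒜.app x z) y)) (hyz : 𝒜.Conv (𝒜.app (𝒜.app x y) z))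
    (hyy : 𝒜.Div (𝒜.app (𝒜.app x y) y)) : 𝒜.ParConvDefinable := by
  obtain ⟨c, hc⟩ := hC.exists
  -- `p = λa b. x (C a z) (C b z)`
  let M : CL A := CL.bracket 𝒜.k 𝒜.s 1 (.app (.app (.const x)
    (.app (.app (.const c) (.var 0)) (.const z))) (.app (.app (.const c) (.var 1)) (.const z)))
  obtain ⟨p, hp, hpa⟩ := h.exists_abs (fun _ => 𝒜.k) 0 M
  have hpab : ∀ a b, 𝒜.Equiv (𝒜.app (𝒜.app p a) b)
      (𝒜.app (𝒜.app x (𝒜.app (𝒜.app c a) z)) (𝒜.app (𝒜.app c b) z)) := fun a b =>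
    (h.app_congr (hpa a) (.refl b)).trans (h.bracket_app _ _ _ _)
  refine ⟨p, hp, fun a => (hpa a).conv_iff.2 (h.conv_bracket _ _ _), fun a b ha => ?_,
    fun a b hb => ?_, fun a b ha hb => ?_⟩
  · refine (hpab a b).conv_iff.2 (QATS.Le.conv ?_ hzy)
    exact h.app_le_app (h.app_le_app (.refl x) (hc.app_equiv h ha z).2) (hy.le _)
  · refine (hpab a b).conv_iff.2 (QATS.Le.conv ?_ hyz)
    exact h.app_le_app (h.app_le_app (.refl x) (hy.le _)) (hc.app_equiv h hb z).2
  · intro h'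
    refine hyy (QATS.Le.conv ?_ ((hpab a b).conv_iff.1 h'))
    exact h.app_le_app (h.app_le_app (.refl x) ((hc.app_div ha z).le y)) ((hc.app_div hb z).le y)

end LTS

/-! ### The domain as a lambda transition system -/

theorem fold_bot : fold ⊥ = ⊥ := rfl

theorem Dom.cases (x : Dom) : x = ⊥ ∨ ∃ g, x = foldFun g := by
  obtain ⟨u, rfl⟩ := fold.surjective x
  cases u using WithBot.recBotCoe with
  | bot => exact .inl rfl
  | coe g => exact .inr ⟨g, rfl⟩

theorem unfold_foldFun (g : ContFun) : unfold (foldFun g) = g :=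
  fold.symm_apply_apply (g : WithBot ContFun)

theorem foldFun_ne_bot (g : ContFun) : foldFun g ≠ ⊥ := fun h =>
  WithBot.coe_ne_bot (fold.injective (h.trans fold_bot.symm) : (g : WithBot ContFun) = ⊥)

theorem ev_bot : domLTS.ev ⊥ = none := by simp [domLTS]

theorem ev_foldFun (g : ContFun) : domLTS.ev (foldFun g) = some g.1 := by
  simp [domLTS, unfold_foldFun]

theorem domApp_bot (e : Dom) : domApp ⊥ e = ⊥ := by simp [domApp]

theorem domApp_foldFun (g : ContFun) (e : Dom) : domApp (foldFun g) e = g.1 e := by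
  simp [domApp, unfold_foldFun]

theorem domApp_abs {g : Dom → Dom} (hg : ScottContinuous g) (e : Dom) :
    domApp (abs g hg) e = g e := domApp_foldFun _ e

theorem abs_ne_bot {g : Dom → Dom} (hg : ScottContinuous g) : abs g hg ≠ ⊥ := foldFun_ne_bot _

theorem dom_app (d e : Dom) : domLTS.app d e = domApp d e := by
  rcases d.cases with rfl | ⟨g, rfl⟩
  · simp [QATS.app, ev_bot, domApp_bot]
  · simp [QATS.app, ev_foldFun, domApp_foldFun]

theorem dom_conv {d : Dom} : domLTS.Conv d ↔ d ≠ ⊥ := by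
  rcases d.cases with rfl | ⟨g, rfl⟩
  · simp [QATS.Conv, ev_bot]
  · simp [QATS.Conv, ev_foldFun, foldFun_ne_bot]

theorem domApp_mono {d d' e e' : Dom} (hd : d ≤ d') (he : e ≤ e') : domApp d e ≤ domApp d' e' := by
  intro m
  obtain ⟨n, hn⟩ := domApp_cont d e m
  exact hn d' e' (proj_mono n hd) (proj_mono n he)

/-- Being different from `⊥` is decided by the first component. -/
theorem ne_bot_of_proj {x y : Dom} (hx : x ≠ ⊥) {n : ℕ} (hn : 1 ≤ n) (h : proj n x ≤ proj n y) :
    y ≠ ⊥ := by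
  rintro rfl
  refine hx (eq_bot_of_step ?_)
  have h1 := (step 0).monotone ((conn n 1).monotone h)
  rw [conn_proj hn, conn_proj hn, step_proj_bot] at h1
  exact le_bot_iff.1 h1

/-- The bisimulation preorder of `D` extends its order. -/
theorem dom_le_of_le {d e : Dom} (h : d ≤ e) : domLTS.Le d e := by
  refine ⟨(· ≤ ·), fun d e h f hf => ?_, h⟩
  rcases d.cases with rfl | ⟨g, rfl⟩
  · simp [ev_bot] at hf
  rcases e.cases with rfl | ⟨g', rfl⟩
  · exact absurd (le_bot_iff.1 h) (foldFun_ne_bot g)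
  rw [ev_foldFun, Option.some_inj] at hf
  subst hf
  refine ⟨g'.1, ev_foldFun g', fun c => ?_⟩
  have := domApp_mono h (le_refl c)
  rwa [domApp_foldFun, domApp_foldFun] at this

theorem emb_le_iff {n : ℕ} {d : Approx n} {x : Dom} : emb n d ≤ x ↔ d ≤ proj n x :=
  ⟨fun h => (conn_self n d).symm.le.trans (proj_mono n h),
    fun h => (emb_mono n h).trans (emb_proj_le n x)⟩

theorem emb_bot (n : ℕ) : emb n (bot n) = ⊥ :=
  le_bot_iff.1 (emb_le_iff.2 (bot_le' n _))

theorem exists_fml_forall {ι : Type*} [Finite ι] (φ : ι → Fml) :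
    ∃ χ : Fml, ∀ x, domLTS.Sat x χ ↔ ∀ i, domLTS.Sat x (φ i) := by
  have : ∀ s : Finset ι, ∃ χ : Fml, ∀ x, domLTS.Sat x χ ↔ ∀ i ∈ s, domLTS.Sat x (φ i) := by
    classical
    intro s
    induction s using Finset.induction_on with
    | empty => exact ⟨.top, fun x => by simp [QATS.Sat]⟩
    | insert i s _ ih =>
      obtain ⟨χ, hχ⟩ := ih
      exact ⟨.and (φ i) χ, fun x => by simp [QATS.Sat, hχ]⟩
  cases nonempty_fintype ι
  obtain ⟨χ, hχ⟩ := this Finset.univ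
  exact ⟨χ, fun x => by simp [hχ]⟩

/-- Every element of `D` that comes from a finite approximant is the least satisfier of a
formula. -/
theorem exists_fml_emb (n : ℕ) (d : Approx n) :
    ∃ χ : Fml, ∀ x, domLTS.Sat x χ ↔ emb n d ≤ x := by
  induction n with
  | zero => exact ⟨.top, fun x => iff_of_true trivial (emb_le_iff.2 (eq_pt _).le)⟩
  | succ n ih =>
    cases hd : step n d using WithBot.recBotCoe with
    | bot =>
      refine ⟨.top, fun x => iff_of_true trivial ?_⟩
      rw [show d = bot (n + 1) from (step n).injective (hd.trans ((step n).apply_symm_apply _).symm),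
        emb_bot]
      exact bot_le
    | coe f =>
      choose χ hχ using ih
      obtain ⟨ξ, hξ⟩ := exists_fml_forall fun e => Fml.arrow (χ e) (χ (f e))
      refine ⟨ξ, fun x => (hξ x).trans ?_⟩
      rw [emb_le_iff, ← (step n).le_iff_le, hd]
      rcases x.cases with rfl | ⟨g, rfl⟩
      · rw [step_proj_bot]
        refine iff_of_false (fun h => ?_) (WithBot.not_coe_le_bot _)
        have := (QATS.sat_arrow.1 (h (bot n))).1
        exact dom_conv.1 this rfl
      · rw [step_proj_foldFun, WithBot.coe_le_coe]
        refine forall_congr' fun e => ?_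
        rw [QATS.sat_arrow]
        simp only [dom_app, domApp_foldFun, hχ]
        show _ ↔ f e ≤ proj n (g.1 (emb n e))
        rw [← emb_le_iff]
        exact ⟨fun h => h.2 _ le_rfl, fun h => ⟨dom_conv.2 (foldFun_ne_bot g),
          fun b hb => h.trans (g.mono hb)⟩⟩

/-- The order of `D` is the logical preorder. -/
theorem dom_le_iff_sat {d e : Dom} : d ≤ e ↔ ∀ φ, domLTS.Sat d φ → domLTS.Sat e φ := by
  refine ⟨fun h φ => QATS.Sat.mono (dom_le_of_le h), fun h n => ?_⟩
  obtain ⟨χ, hχ⟩ := exists_fml_emb n (proj n d)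
  exact emb_le_iff.1 ((hχ e).1 (h χ ((hχ d).2 (emb_proj_le n d))))

theorem dom_le_iff {d e : Dom} : domLTS.Le d e ↔ d ≤ e :=
  ⟨fun h => dom_le_iff_sat.2 fun _ => QATS.Sat.mono h, dom_le_of_le⟩

theorem dom_equiv_iff {d e : Dom} : domLTS.Equiv d e ↔ d = e := by
  rw [QATS.Equiv, dom_le_iff, dom_le_iff, le_antisymm_iff]

theorem domK_app (x y : Dom) : domApp (domApp domK x) y = x := by
  simp only [domK, domApp_abs]

theorem domS_app (x y z : Dom) :
    domApp (domApp (domApp domS x) y) z = domApp (domApp x z) (domApp y z) := by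
  simp only [domS, domApp_abs]

theorem dom_isLTS : domLTS.IsLTS where
  isATS a b c f hf hbc := by
    rw [← QATS.app_of_ev hf, ← QATS.app_of_ev hf, dom_app, dom_app]
    exact dom_le_of_le (domApp_mono le_rfl (dom_le_iff.1 hbc))
  k_conv := dom_conv.2 (abs_ne_bot _)
  k_conv₁ x := by
    rw [dom_conv, dom_app, show domLTS.k = domK from rfl, domK, domApp_abs]
    exact abs_ne_bot _
  k_app x y := by
    rw [dom_equiv_iff, dom_app, dom_app]
    exact domK_app x y
  s_conv := dom_conv.2 (abs_ne_bot _)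
  s_conv₁ x := by
    rw [dom_conv, dom_app, show domLTS.s = domS from rfl, domS, domApp_abs]
    exact abs_ne_bot _
  s_conv₂ x y := by
    rw [dom_conv, dom_app, dom_app, show domLTS.s = domS from rfl, domS, domApp_abs, domApp_abs]
    exact abs_ne_bot _
  s_app x y z := by
    simp only [dom_equiv_iff, dom_app]
    exact domS_app x y z

namespace QATS

variable {A : Type*} {𝒜 : QATS A}

theorem Sat.foldr_mono {ψ ψ' : Fml} (h : ∀ x, 𝒜.Sat x ψ → 𝒜.Sat x ψ') {a : A} {φs : List Fml}
    (ha : 𝒜.Sat a (φs.foldr Fml.arrow ψ)) : 𝒜.Sat a (φs.foldr Fml.arrow ψ') := by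
  induction φs generalizing a with
  | nil => exact h a ha
  | cons φ φs ih =>
    obtain ⟨f, hf, h⟩ := ha
    exact ⟨f, hf, fun b hb => ih (h b hb)⟩

end QATS

/-- By continuity, finitely much information about the arguments suffices for each component of the
value of an application. -/
theorem dom_exists_sat_foldr (d : Dom) (bs : List Dom) (hc : domLTS.Conv (bs.foldl domLTS.app d))
    (m : ℕ) : ∃ φs : List Fml, List.Forall₂ domLTS.Sat bs φs ∧ ∀ χ,
      (∀ x, domLTS.Sat x χ ↔ emb m (proj m (bs.foldl domLTS.app d)) ≤ x) →
        domLTS.Sat d (φs.foldr Fml.arrow χ) := by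
  induction bs using List.reverseRecOn generalizing m with
  | nil => exact ⟨[], .nil, fun χ hχ => (hχ d).2 (emb_proj_le m d)⟩
  | append_singleton bs b ih =>
    rw [List.foldl_append, List.foldl_cons, List.foldl_nil] at hc ⊢
    set d' := bs.foldl domLTS.app d
    have hc' : domLTS.Conv d' := hc.of_app
    obtain ⟨n, hn⟩ := domApp_cont d' b m
    obtain ⟨φs, hφs, h⟩ := ih hc' (max n 1)
    obtain ⟨χ', hχ'⟩ := exists_fml_emb (max n 1) (proj (max n 1) d')
    obtain ⟨θ, hθ⟩ := exists_fml_emb n (proj n b)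
    refine ⟨φs ++ [θ], List.rel_append hφs (.cons ((hθ b).2 (emb_proj_le n b)) .nil),
      fun χ hχ => ?_⟩
    rw [List.foldr_append]
    refine QATS.Sat.foldr_mono (fun x hx => ?_) (h χ' hχ')
    have hx := emb_le_iff.1 ((hχ' x).1 hx)
    refine QATS.sat_arrow.2 ⟨dom_conv.2 (ne_bot_of_proj (dom_conv.1 hc') (le_max_right n 1) hx),
      fun y hy => (hχ _).2 (emb_le_iff.2 ?_)⟩
    rw [dom_app, dom_app]
    refine hn x y ?_ (emb_le_iff.1 ((hθ y).1 hy))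
    rw [← conn_proj (le_max_left n 1) d', ← conn_proj (le_max_left n 1) x]
    exact (conn _ n).monotone hx

theorem dom_approximable : domLTS.Approximable := by
  intro d bs hc
  obtain ⟨φs, hφs, h⟩ := dom_exists_sat_foldr d bs hc 1
  obtain ⟨χ, hχ⟩ := exists_fml_emb 1 (proj 1 (bs.foldl domLTS.app d))
  refine ⟨φs, hφs, QATS.Sat.foldr_mono (fun x hx => ?_) (h χ hχ)⟩
  exact QATS.sat_lam.2 (dom_conv.2 (ne_bot_of_proj (dom_conv.1 hc) le_rfl
    (emb_le_iff.1 ((hχ x).1 hx))))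

/-! ### Convergence testing and parallel convergence in the domain -/

/-- The identity, as an element of `D`. -/
noncomputable def domI : Dom := abs (fun d => d) cont_id

theorem domI_app (d : Dom) : domApp domI d = d := domApp_abs _ d

theorem domI_ne_bot : domI ≠ ⊥ := abs_ne_bot _

theorem dom_ext {d e : Dom} (hd : d ≠ ⊥) (he : e ≠ ⊥) (h : ∀ x, domApp d x = domApp e x) :
    d = e := by
  rcases d.cases with rfl | ⟨g, rfl⟩
  · exact absurd rfl hd
  rcases e.cases with rfl | ⟨g', rfl⟩
  · exact absurd rfl he
  refine congrArg foldFun (Subtype.ext (funext fun x => ?_))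
  simpa only [domApp_foldFun] using h x

theorem dom_i : domLTS.i = domI := by
  refine dom_ext (dom_conv.1 dom_isLTS.i_conv) domI_ne_bot fun x => ?_
  rw [domI_app, ← dom_app]
  exact dom_equiv_iff.1 (dom_isLTS.i_app x)

open Classical in
/-- The element of `D` that is the identity if `p` holds, and `⊥` otherwise. -/
noncomputable def guard (p : Prop) : Dom := if p then domI else ⊥

theorem guard_pos {p : Prop} (h : p) : guard p = domI := if_pos h

theorem guard_neg {p : Prop} (h : ¬ p) : guard p = ⊥ := if_neg h

theorem guard_ne_bot_iff {p : Prop} : guard p ≠ ⊥ ↔ p := by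
  by_cases h : p
  · rw [guard_pos h]
    exact iff_of_true domI_ne_bot h
  · rw [guard_neg h]
    exact iff_of_false (fun h' => h' rfl) h

theorem cont_guard {p : Dom → Prop} (hp : ∀ x y, p x → proj 1 x ≤ proj 1 y → p y) :
    ScottContinuous fun d => guard (p d) := by
  refine scottContinuous_iff.2 fun x m => ⟨1, fun y hy => proj_mono m ?_⟩
  by_cases hx : p x
  · rw [guard_pos hx, guard_pos (hp x y hx hy)]
  · exact (guard_neg hx).le.trans bot_le

theorem dom_convTest : domLTS.ConvTestDefinable := by
  have hcont := cont_guard (p := fun d => d ≠ ⊥) fun x y hx => ne_bot_of_proj hx le_rfl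
  refine ⟨abs _ hcont, dom_conv.2 (abs_ne_bot _), fun x hx => ?_, fun x hx => ?_⟩
  · rw [QATS.Div, dom_conv] at hx ⊢
    rw [dom_app, domApp_abs, guard_neg hx, ne_eq, not_not]
  · rw [dom_conv] at hx
    rw [dom_equiv_iff, dom_app, domApp_abs, dom_i, guard_pos hx]

theorem domPar_cont (d : Dom) : ScottContinuous fun e : Dom => guard (d ≠ ⊥ ∨ e ≠ ⊥) :=
  cont_guard fun _ _ h h' => h.imp_right fun hx => ne_bot_of_proj hx le_rfl h'

theorem domPar_cont' (e : Dom) : ScottContinuous fun d : Dom => guard (d ≠ ⊥ ∨ e ≠ ⊥) :=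
  cont_guard fun _ _ h h' => h.imp_left fun hx => ne_bot_of_proj hx le_rfl h'

/-- Parallel convergence, as an element of `D`. -/
noncomputable def domPar : Dom := abs _ (abs_comp domPar_cont domPar_cont')

theorem domPar_ne_bot : domPar ≠ ⊥ := abs_ne_bot _

theorem domPar_app_ne_bot (d : Dom) : domApp domPar d ≠ ⊥ := by
  rw [domPar, domApp_abs]
  exact abs_ne_bot _

theorem domPar_app_app (d e : Dom) : domApp (domApp domPar d) e = guard (d ≠ ⊥ ∨ e ≠ ⊥) := by
  rw [domPar, domApp_abs, domApp_abs]

theorem domPar_app_of_ne {d e : Dom} (h : d ≠ ⊥ ∨ e ≠ ⊥) : domApp (domApp domPar d) e = domI :=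
  (domPar_app_app d e).trans (guard_pos h)

theorem domPar_app_bot : domApp (domApp domPar ⊥) ⊥ = ⊥ :=
  (domPar_app_app ⊥ ⊥).trans (guard_neg (by simp))

theorem dom_parConv : domLTS.ParConvDefinable := by
  refine ⟨domPar, dom_conv.2 domPar_ne_bot, fun x => ?_, fun x y hx => ?_, fun x y hy => ?_,
    fun x y hx hy => ?_⟩
  · rw [dom_conv, dom_app]
    exact domPar_app_ne_bot x
  · rw [dom_conv] at hx ⊢
    rw [dom_app, dom_app, domPar_app_of_ne (.inl hx)]
    exact domI_ne_bot
  · rw [dom_conv] at hy ⊢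
    rw [dom_app, dom_app, domPar_app_of_ne (.inr hy)]
    exact domI_ne_bot
  · have hx' : x = ⊥ := by simpa [QATS.Div, dom_conv] using hx
    have hy' : y = ⊥ := by simpa [QATS.Div, dom_conv] using hy
    rw [QATS.Div, dom_conv, dom_app, dom_app, hx', hy', domPar_app_bot]
    simp

theorem dom_div_bot : domLTS.Div ⊥ := fun h => dom_conv.1 h rfl

theorem dom_expressive : domLTS.Expressive :=
  LTS.expressive_of_parConv dom_isLTS dom_convTest dom_parConv dom_div_bot

theorem dom_testable : domLTS.Testable :=
  LTS.testable_of_parConv dom_isLTS dom_convTest dom_parConv dom_div_bot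

/-! ### Compact elements and filters of formulae -/

/-- The least element of `D` that satisfies `φ`. -/
noncomputable def least (φ : Fml) : Dom := (dom_expressive φ).choose

theorem sat_least {φ ψ : Fml} : domLTS.Sat (least φ) ψ ↔ Fml.Entails φ ψ :=
  (dom_expressive φ).choose_spec ψ

theorem least_le_iff {φ : Fml} {d : Dom} : least φ ≤ d ↔ domLTS.Sat d φ := by
  rw [dom_le_iff_sat]
  exact ⟨fun h => h φ (sat_least.2 (.refl φ)), fun h ψ hψ => h.entails (sat_least.1 hψ)⟩

theorem dom_sat_arrow {d : Dom} {φ ψ : Fml} :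
    domLTS.Sat d (.arrow φ ψ) ↔ d ≠ ⊥ ∧ domLTS.Sat (domApp d (least φ)) ψ := by
  rw [QATS.sat_arrow, dom_conv]
  refine and_congr_right fun _ => ⟨fun h => ?_, fun h b hb => ?_⟩
  · rw [← dom_app]
    exact h _ (least_le_iff.1 le_rfl)
  · rw [dom_app]
    exact h.mono (dom_le_of_le (domApp_mono le_rfl (least_le_iff.2 hb)))

/-- Satisfaction is Scott open. -/
theorem dom_sat_open {d : Dom} {φ : Fml} (h : domLTS.Sat d φ) :
    ∃ n, ∀ e, proj n d ≤ proj n e → domLTS.Sat e φ := by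
  have hle : ∀ {n m : ℕ}, n ≤ m → ∀ {x y : Dom}, proj m x ≤ proj m y → proj n x ≤ proj n y := by
    intro n m hnm x y hxy
    rw [← conn_proj hnm x, ← conn_proj hnm y]
    exact (conn m n).monotone hxy
  induction φ generalizing d with
  | top => exact ⟨0, fun _ _ => trivial⟩
  | and φ ψ ih₁ ih₂ =>
    obtain ⟨n₁, h₁⟩ := ih₁ h.1
    obtain ⟨n₂, h₂⟩ := ih₂ h.2
    exact ⟨max n₁ n₂, fun e he => ⟨h₁ e (hle (le_max_left _ _) he), h₂ e (hle (le_max_right _ _) he)⟩⟩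
  | arrow φ ψ _ ih =>
    rw [dom_sat_arrow] at h
    obtain ⟨n, hn⟩ := ih h.2
    obtain ⟨m, hm⟩ := domApp_cont d (least φ) n
    refine ⟨max m 1, fun e he => dom_sat_arrow.2
      ⟨ne_bot_of_proj h.1 (le_max_right m 1) he, hn _ (hm _ _ (hle (le_max_left _ _) he) le_rfl)⟩⟩

/-- Every filter of formulae is the set of formulae satisfied by an element of `D`. -/
theorem exists_sat_iff_mem {F : Set Fml} (h₁ : .top ∈ F)
    (h₂ : ∀ φ ∈ F, ∀ ψ ∈ F, .and φ ψ ∈ F) (h₃ : ∀ φ ∈ F, ∀ ψ, Fml.Entails φ ψ → ψ ∈ F) :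
    ∃ d, ∀ φ, domLTS.Sat d φ ↔ φ ∈ F := by
  have hne : (least '' F).Nonempty := ⟨_, _, h₁, rfl⟩
  have hdir : DirectedOn (· ≤ ·) (least '' F) := by
    rintro _ ⟨φ, hφ, rfl⟩ _ ⟨ψ, hψ, rfl⟩
    exact ⟨_, ⟨_, h₂ φ hφ ψ hψ, rfl⟩, least_le_iff.2 (sat_least.2 (.and_left _ _)),
      least_le_iff.2 (sat_least.2 (.and_right _ _))⟩
  obtain ⟨d, hd, h⟩ := exists_isLUB hne hdir
  refine ⟨d, fun φ => ⟨fun hφ => ?_, fun hφ => least_le_iff.1 (hd.1 ⟨φ, hφ, rfl⟩)⟩⟩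
  obtain ⟨n, hn⟩ := dom_sat_open hφ
  obtain ⟨_, ⟨ψ, hψ, rfl⟩, hs⟩ := h n
  exact h₃ ψ hψ φ (sat_least.1 (hn _ hs.le))

/-- A compact element is its own projection to some approximant, and hence a least satisfier. -/
theorem exists_eq_least_of_isCompact {d : Dom} (hd : IsCompactElement d) : ∃ φ, d = least φ := by
  have hdir : DirectedOn (· ≤ ·) (Set.range fun n => emb n (proj n d)) := by
    refine directedOn_range.2 (Monotone.directed_le (monotone_nat_of_le_succ fun n => ?_))
    rw [← emb_conn (Nat.le_succ n)]
    exact emb_mono _ (emb_proj_le n d (n + 1))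
  have hlub : IsLUB (Set.range fun n => emb n (proj n d)) d :=
    isLUB_of_proj (by rintro _ ⟨n, rfl⟩; exact emb_proj_le n d)
      fun n => ⟨_, ⟨n, rfl⟩, (conn_self n _).symm.le⟩
  obtain ⟨_, ⟨n, rfl⟩, hn⟩ := hd _ d (Set.range_nonempty _) hdir hlub le_rfl
  obtain ⟨φ, hφ⟩ := exists_fml_emb n (proj n d)
  refine ⟨φ, le_antisymm (hn.trans ?_) (least_le_iff.2 ((hφ d).2 (emb_proj_le n d)))⟩
  exact (hφ _).1 (least_le_iff.1 le_rfl)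

theorem dom_exists_sat_arrow {d e : Dom} {ψ : Fml} (hd : d ≠ ⊥) (h : domLTS.Sat (domApp d e) ψ) :
    ∃ φ, domLTS.Sat d (.arrow φ ψ) ∧ domLTS.Sat e φ :=
  LTS.exists_sat_arrow dom_isLTS dom_approximable dom_testable (dom_conv.2 hd)
    (by rwa [dom_app])

/-! ### The formula of parallel convergence -/

/-- The formula that describes the two ways in which parallel convergence converges. -/
def parFml : Fml := .and (.arrow .lam (.arrow .top .lam)) (.arrow .top (.arrow .lam .lam))

theorem sat_parFml_domPar : domLTS.Sat domPar parFml := by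
  have h : ∀ d e : Dom, d ≠ ⊥ ∨ e ≠ ⊥ →
      domLTS.Sat (domLTS.app (domLTS.app domPar d) e) .lam := fun d e hde => by
    rw [QATS.sat_lam, dom_app, dom_app, domPar_app_of_ne hde, dom_conv]
    exact domI_ne_bot
  have h₁ : domLTS.Conv domPar := dom_conv.2 domPar_ne_bot
  have h₂ : ∀ d, domLTS.Conv (domLTS.app domPar d) := fun d => by
    rw [dom_app, dom_conv]
    exact domPar_app_ne_bot d
  refine ⟨QATS.sat_arrow.2 ⟨h₁, fun d hd => QATS.sat_arrow.2 ⟨h₂ d, fun e _ => h d e (.inl ?_)⟩⟩,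
    QATS.sat_arrow.2 ⟨h₁, fun d _ => QATS.sat_arrow.2 ⟨h₂ d, fun e he => h d e (.inr ?_)⟩⟩⟩
  · exact dom_conv.1 (QATS.sat_lam.1 hd)
  · exact dom_conv.1 (QATS.sat_lam.1 he)

/-- Parallel convergence needs one of its arguments to converge. -/
theorem not_parFml_entails {φ ψ : Fml} (hφ : Fml.Entails .top φ) (hψ : Fml.Entails .top ψ) :
    ¬ Fml.Entails parFml (.arrow φ (.arrow ψ .lam)) := fun h => by
  have h₀ : ∀ {θ}, Fml.Entails .top θ → domLTS.Sat ⊥ θ := fun h => QATS.Sat.entails h trivial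
  have h₁ := (QATS.sat_arrow.1 (sat_parFml_domPar.entails h)).2 ⊥ (h₀ hφ)
  have h₂ := QATS.sat_lam.1 ((QATS.sat_arrow.1 h₁).2 ⊥ (h₀ hψ))
  rw [dom_app, dom_app, domPar_app_bot] at h₂
  exact dom_div_bot h₂

namespace LTS

variable {A : Type*} {𝒜 : LTS A}

theorem conv_of_sat_parFml {x y z : A} (hx : 𝒜.Sat x parFml) (hz : 𝒜.Conv z) :
    𝒜.Conv (𝒜.app (𝒜.app x z) y) ∧ 𝒜.Conv (𝒜.app (𝒜.app x y) z) :=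
  ⟨QATS.sat_lam.1 ((QATS.sat_arrow.1 ((QATS.sat_arrow.1 hx.1).2 z (QATS.sat_lam.2 hz))).2 y trivial),
    QATS.sat_lam.1 ((QATS.sat_arrow.1 ((QATS.sat_arrow.1 hx.2).2 y trivial)).2 z
      (QATS.sat_lam.2 hz))⟩

theorem parConv_of_sat_parFml (h : 𝒜.IsLTS) (hC : 𝒜.ConvTestDefinable) {x y : A}
    (hx : 𝒜.Sat x parFml) (hyy : 𝒜.Div (𝒜.app (𝒜.app x y) y)) : 𝒜.ParConvDefinable := by
  have hk := conv_of_sat_parFml (y := y) hx h.k_conv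
  exact parConvDefinable_of h hC (fun hy => hyy (conv_of_sat_parFml hx hy).1) hk.1 hk.2 hyy

/-! ### The conditions that imply parallel convergence -/

theorem parConv_of_expressive (h : 𝒜.IsLTS) (hA : 𝒜.Approximable) (hC : 𝒜.ConvTestDefinable)
    (hE : 𝒜.Expressive) : 𝒜.ParConvDefinable := by
  obtain ⟨x, hx⟩ := hE parFml
  obtain ⟨o, ho⟩ := hE .top
  refine parConv_of_sat_parFml h hC ((hx _).2 (.refl _)) (y := o) fun hoo => ?_
  obtain ⟨φs, ho', hx'⟩ := hA x [o, o] hoo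
  rcases ho' with _ | ⟨h₁, h'⟩
  rcases h' with _ | ⟨h₂, h'⟩
  cases h'
  exact not_parFml_entails ((ho _).1 h₁) ((ho _).1 h₂) ((hx _).1 hx')

theorem parConv_of_complete (h : 𝒜.IsLTS) (hC : 𝒜.ConvTestDefinable) (hc : 𝒜.Complete) :
    𝒜.ParConvDefinable := by
  let Γ : ℕ → Fml := Function.update (fun _ => .top) 0 parFml
  let M : PureLam := .app (.app (.var 0) (.var 1)) (.var 1)
  have hnot : ¬ Derives M Γ .lam := fun hd => by
    have := dom_isLTS.models_of_derives hd (fun n => if n = 0 then domPar else ⊥) fun n => by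
      rcases n with _ | n
      · exact sat_parFml_domPar
      · simp [Γ, QATS.Sat]
    rw [QATS.sat_lam] at this
    simp only [M, interp, Lam.toCL, CL.eval, dom_app] at this
    exact dom_conv.1 this domPar_app_bot
  rw [hc, Models] at hnot
  push Not at hnot
  obtain ⟨ρ, hρ, hM⟩ := hnot
  exact parConv_of_sat_parFml h hC (x := ρ 0) (y := ρ 1) (hρ 0) fun h' => hM (QATS.sat_lam.2 h')

/-- The conditional formula used here states that no element separates `(y, z)` and `(z, y)`
from `(y, y)`, where `y` diverges. -/
theorem parConv_of_fullyAbstract (h : 𝒜.IsLTS) (hC : 𝒜.ConvTestDefinable)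
    (hF : 𝒜.FullyAbstract) : 𝒜.ParConvDefinable := by
  let T : ℕ → ℕ → PureLam := fun m n => .app (.app (.var 0) (.var m)) (.var n)
  let F : CondFml := ⟨[T 2 1, T 1 2], [.var 1, T 1 1], .div (T 2 1)⟩
  let ρ : ℕ → Dom := fun n => if n = 0 then domPar else if n = 1 then ⊥ else domI
  have hD : F ∉ domLTS.theory := fun hmem => by
    have hT : ∀ m n, domLTS.Conv (domLTS.interp ρ (T (m + 1) (n + 1))) ↔ m ≠ 0 ∨ n ≠ 0 := by
      have hI : ∀ m : ℕ, (if m = 0 then ⊥ else domI) ≠ ⊥ ↔ m ≠ 0 := fun m => by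
        by_cases hm : m = 0 <;> simp [hm, domI_ne_bot]
      intro m n
      rw [dom_conv, ← hI m, ← hI n]
      refine Iff.trans ?_ guard_ne_bot_iff
      rw [← domPar_app_app]
      simp [ρ, T, interp, Lam.toCL, CL.eval, dom_app]
    refine hmem ρ ?_ ?_ ((hT 1 0).2 (.inl one_ne_zero))
    · intro M hM
      simp only [F, List.mem_cons, List.not_mem_nil, or_false] at hM
      rcases hM with rfl | rfl
      · exact (hT 1 0).2 (.inl one_ne_zero)
      · exact (hT 0 1).2 (.inr one_ne_zero)
    · intro M hM
      simp only [F, List.mem_cons, List.not_mem_nil, or_false] at hM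
      rcases hM with rfl | rfl
      · exact dom_div_bot
      · exact fun h' => by simpa using (hT 0 0).1 h'
  rw [← show 𝒜.theory = domLTS.theory from hF, theory, Set.mem_ofPred_eq] at hD
  push Not at hD
  obtain ⟨ρ, h₁, h₂, -⟩ := hD
  exact parConvDefinable_of h hC (x := ρ 0) (y := ρ 1) (z := ρ 2) (h₂ (.var 1) (by simp [F]))
    (h₁ (T 2 1) (by simp [F])) (h₁ (T 1 2) (by simp [F])) (h₂ (T 1 1) (by simp [F]))

/-! ### Completeness of the program logic -/

/-- Derivability is satisfaction under the environment of least satisfiers. -/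
theorem complete_of_expressive (h : 𝒜.IsLTS) (hA : 𝒜.Approximable) (hE : 𝒜.Expressive)
    (hT : 𝒜.Testable) : 𝒜.Complete := by
  choose e he using hE
  have key : ∀ (M : PureLam) (Γ : ℕ → Fml) (φ : Fml),
      𝒜.Sat (𝒜.interp (fun x => e (Γ x)) M) φ → Derives M Γ φ := by
    intro M
    induction M with
    | var x =>
      intro Γ φ hφ
      have hv := Derives.var x Γ (Γ x)
      rw [Function.update_eq_self] at hv
      exact .leq (fun _ => .refl _) hv ((he _ _).1 hφ)
    | const c => exact c.elim
    | app M N ihM ihN =>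
      intro Γ φ hφ
      by_cases hM : 𝒜.Conv (𝒜.interp (fun x => e (Γ x)) M)
      · obtain ⟨ψ, hMψ, hNψ⟩ := exists_sat_arrow h hA hT hM hφ
        exact .app (ihM Γ _ hMψ) (ihN Γ _ hNψ)
      · have happ : 𝒜.Div (𝒜.interp (fun x => e (Γ x)) (.app M N)) := QATS.Div.app' hM _
        exact .leq (fun _ => .refl _) (.top _ _) ((he _ _).1 (hφ.mono (happ.le _)))
    | lam x M ih =>
      intro Γ φ hφ
      induction φ with
      | top => exact .top _ _
      | and φ ψ ih₁ ih₂ => exact .and (ih₁ hφ.1) (ih₂ hφ.2)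
      | arrow φ ψ =>
        refine .abs (ih _ _ ?_)
        have := (QATS.sat_arrow.1 hφ).2 (e φ) ((he _ _).2 (.refl φ))
        rw [(h.interp_lam_app _ _ _ _).sat_iff] at this
        convert this using 2
        funext y
        by_cases hy : y = x
        · subst hy; simp
        · simp [hy]
  exact fun M Γ φ => ⟨h.models_of_derives, fun hm =>
    key M Γ φ (hm _ fun x => (he _ _).2 (.refl _))⟩

/-! ### The canonical map into the domain -/

theorem exists_isCanonicalMap (𝒜 : LTS A) : ∃ t : A → Dom, 𝒜.IsCanonicalMap t := by
  have h : ∀ a, ∃ d, ∀ φ, domLTS.Sat d φ ↔ φ ∈ {φ | 𝒜.Sat a φ} := fun a =>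
    exists_sat_iff_mem (F := {φ | 𝒜.Sat a φ}) trivial (fun _ h₁ _ h₂ => ⟨h₁, h₂⟩)
      fun _ h₁ _ h₂ => h₁.entails h₂
  choose t ht using h
  refine ⟨t, fun a φ => (ht a φ).symm, fun t' ht' => funext fun a => le_antisymm ?_ ?_⟩
  · exact dom_le_iff_sat.2 fun φ hφ => (ht a φ).2 ((ht' a φ).2 hφ)
  · exact dom_le_iff_sat.2 fun φ hφ => (ht' a φ).1 ((ht a φ).1 hφ)

namespace IsMorphism

variable {t : A → Dom} (ht : 𝒜.IsMorphism t)
include ht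

theorem conv_iff {a : A} : 𝒜.Conv a ↔ domLTS.Conv (t a) := by
  rw [← QATS.sat_lam, ← QATS.sat_lam, ht]

theorem le_iff (hA : 𝒜.Approximable) {a b : A} : 𝒜.Le a b ↔ t a ≤ t b := by
  simp only [hA.le_iff, dom_le_iff_sat, ht a, ht b]

theorem eq_iff (hA : 𝒜.Approximable) {a b : A} : t a = t b ↔ 𝒜.Equiv a b := by
  rw [QATS.Equiv, ht.le_iff hA, ht.le_iff hA, le_antisymm_iff]

theorem map_app (h : 𝒜.IsLTS) (hA : 𝒜.Approximable) (hT : 𝒜.Testable) (a b : A) :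
    t (𝒜.app a b) = domApp (t a) (t b) := by
  by_cases ha : 𝒜.Conv a
  · have hta := dom_conv.1 (ht.conv_iff.1 ha)
    refine le_antisymm (dom_le_iff_sat.2 fun ψ hψ => ?_) (dom_le_iff_sat.2 fun ψ hψ => ?_)
    · obtain ⟨φ, h₁, h₂⟩ := exists_sat_arrow h hA hT ha ((ht _ _).2 hψ)
      rw [← dom_app]
      exact (QATS.sat_arrow.1 ((ht _ _).1 h₁)).2 _ ((ht _ _).1 h₂)
    · obtain ⟨φ, h₁, h₂⟩ := dom_exists_sat_arrow hta hψ
      exact (ht _ _).1 ((QATS.sat_arrow.1 ((ht _ _).2 h₁)).2 _ ((ht _ _).2 h₂))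
  · have hta : t a = ⊥ := by
      by_contra hne
      exact ha (ht.conv_iff.2 (dom_conv.2 hne))
    rw [QATS.Div.app ha, hta, domApp_bot]

theorem eq_least {φ : Fml} {a : A} (ha : ∀ ψ, 𝒜.Sat a ψ ↔ Fml.Entails φ ψ) : t a = least φ :=
  le_antisymm (dom_le_iff_sat.2 fun ψ hψ => sat_least.2 ((ha ψ).1 ((ht _ _).2 hψ)))
    (least_le_iff.2 ((ht _ _).1 ((ha φ).2 (.refl φ))))

end IsMorphism

end LTS

/-- Extensionality in `D` with compact arguments. -/
theorem dom_ext_least {d e : Dom} (hd : d ≠ ⊥) (he : e ≠ ⊥)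
    (h : ∀ φ, domApp d (least φ) = domApp e (least φ)) : d = e := by
  have H : ∀ {d e : Dom}, d ≠ ⊥ → (∀ φ, domApp d (least φ) = domApp e (least φ)) → ∀ x,
      domApp d x ≤ domApp e x := fun {d e} hd h x => dom_le_iff_sat.2 fun ψ hψ => by
    obtain ⟨φ, h₁, h₂⟩ := dom_exists_sat_arrow hd hψ
    have h₃ := (dom_sat_arrow.1 h₁).2
    rw [h φ] at h₃
    exact h₃.mono (dom_le_of_le (domApp_mono le_rfl (least_le_iff.2 h₂)))
  exact dom_ext hd he fun x => le_antisymm (H hd h x) (H he (fun φ => (h φ).symm) x)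

namespace LTS

variable {A : Type*} {𝒜 : LTS A}

/-- The canonical map is an embedding whose image contains the compact elements.  It maps `k` and `s`
to the corresponding elements of `D` because both satisfy the same equations on the images of the
least satisfiers, which are the least elements of `D` that satisfy a formula. -/
theorem exists_embedding (h : 𝒜.IsLTS) (hA : 𝒜.Approximable) (hE : 𝒜.Expressive)
    (hT : 𝒜.Testable) : ∃ t : A → Dom, 𝒜.IsCanonicalMap t ∧ 𝒜.IsCombinatoryEmbedding t ∧
      {d | IsCompactElement d} ⊆ Set.range t := by
  obtain ⟨t, ht, ht'⟩ := exists_isCanonicalMap 𝒜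
  have happ := ht.map_app h hA hT
  choose e he using hE
  have hl : ∀ φ, least φ = t (e φ) := fun φ => (ht.eq_least (he φ)).symm
  have hconv : ∀ {a}, 𝒜.Conv a → t a ≠ ⊥ := fun ha => dom_conv.1 (ht.conv_iff.1 ha)
  have heq : ∀ {a b}, 𝒜.Equiv a b → t a = t b := fun hab => (ht.eq_iff hA).2 hab
  refine ⟨t, ⟨ht, ht'⟩, ⟨fun a b => (happ a b).trans (dom_app _ _).symm, ?_, ?_,
    fun a b => ht.eq_iff hA⟩, fun d hd => ?_⟩
  · refine dom_ext_least (hconv h.k_conv) (dom_conv.1 dom_isLTS.k_conv) fun φ => ?_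
    rw [hl, ← happ]
    refine dom_ext_least (hconv (h.k_conv₁ _)) ?_ fun ψ => ?_
    · rw [← dom_app]
      exact dom_conv.1 (dom_isLTS.k_conv₁ _)
    · rw [hl, ← happ, heq (h.k_app _ _)]
      exact (domK_app _ _).symm
  · refine dom_ext_least (hconv h.s_conv) (dom_conv.1 dom_isLTS.s_conv) fun φ => ?_
    rw [hl, ← happ]
    refine dom_ext_least (hconv (h.s_conv₁ _)) ?_ fun ψ => ?_
    · rw [← dom_app]
      exact dom_conv.1 (dom_isLTS.s_conv₁ _)
    rw [hl, ← happ]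
    refine dom_ext_least (hconv (h.s_conv₂ _ _)) ?_ fun χ => ?_
    · rw [← dom_app, ← dom_app]
      exact dom_conv.1 (dom_isLTS.s_conv₂ _ _)
    · rw [hl, ← happ, heq (h.s_app _ _ _), happ, happ, happ]
      exact (domS_app _ _ _).symm
  · obtain ⟨φ, rfl⟩ := exists_eq_least_of_isCompact hd
    exact ⟨e φ, (hl φ).symm⟩

end LTS

/-! ### Transfer of theories -/

namespace CL

variable {A B : Type*}

/-- The action of a map on the constants of combinatory terms. -/
def map (t : A → B) : CL A → CL B
  | var x => var x
  | const a => const (t a)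
  | app M N => app (map t M) (map t N)

theorem fv_map (t : A → B) (M : CL A) : (map t M).fv = M.fv := by
  induction M with
  | var x => rfl
  | const a => rfl
  | app M N ih₁ ih₂ => simp only [map, fv, ih₁, ih₂]

theorem map_bracket (t : A → B) (k s : A) (x : ℕ) (M : CL A) :
    map t (bracket k s x M) = bracket (t k) (t s) x (map t M) := by
  induction M with
  | var y => unfold bracket; simp only [map]; split_ifs <;> rfl
  | const a => rfl
  | app M N ih₁ ih₂ =>
    have hfv : fv (app (map t M) (map t N)) = fv (app M N) := fv_map t (app M N)
    rw [map, bracket, bracket, hfv]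
    split_ifs
    · simp only [map, ih₁, ih₂]
    · rfl

theorem eval_map {𝒜 : QATS A} {ℬ : QATS B} {t : A → B}
    (h : ∀ a b, t (𝒜.app a b) = ℬ.app (t a) (t b)) (ρ : ℕ → A) (M : CL A) :
    eval ℬ (fun x => t (ρ x)) (map t M) = t (eval 𝒜 ρ M) := by
  induction M with
  | var x => rfl
  | const a => rfl
  | app M N ih₁ ih₂ => simp only [map, eval, ih₁, ih₂, h]

end CL

theorem Lam.map_toCL {A B : Type*} (t : A → B) (k s : A) (M : PureLam) :
    (M.toCL k s).map t = M.toCL (t k) (t s) := by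
  induction M with
  | var x => rfl
  | const c => exact c.elim
  | app M N ih₁ ih₂ => simp only [toCL, CL.map, ih₁, ih₂]
  | lam x M ih => simp only [toCL, CL.map_bracket, ih]

namespace LTS

variable {A : Type*} {𝒜 : LTS A}

theorem interp_map {t : A → Dom} (h : ∀ a b, t (𝒜.app a b) = domLTS.app (t a) (t b))
    (hk : t 𝒜.k = domLTS.k) (hs : t 𝒜.s = domLTS.s) (ρ : ℕ → A) (M : PureLam) :
    domLTS.interp (fun x => t (ρ x)) M = t (𝒜.interp ρ M) := by
  rw [interp, ← hk, ← hs, ← Lam.map_toCL]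
  exact CL.eval_map h ρ _

end LTS

/-- Interpretation in `D` is continuous in the environment. -/
theorem eval_cont (ρ : ℕ → Dom) (M : CL Dom) (m : ℕ) : ∃ n, ∀ k ≥ n, ∀ ρ' : ℕ → Dom,
    (∀ x, proj k (ρ x) ≤ proj k (ρ' x)) →
      proj m (M.eval domLTS.toQATS ρ) ≤ proj m (M.eval domLTS.toQATS ρ') := by
  induction M generalizing m with
  | var x =>
    refine ⟨m, fun k hk ρ' h => ?_⟩
    have := (conn k m).monotone (h x)
    rwa [conn_proj hk, conn_proj hk] at this
  | const a => exact ⟨0, fun _ _ _ _ => le_rfl⟩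
  | app M N ih₁ ih₂ =>
    obtain ⟨n, hn⟩ := domApp_cont (M.eval domLTS.toQATS ρ) (N.eval domLTS.toQATS ρ) m
    obtain ⟨n₁, h₁⟩ := ih₁ n
    obtain ⟨n₂, h₂⟩ := ih₂ n
    refine ⟨max n₁ n₂, fun k hk ρ' h => ?_⟩
    simp only [CL.eval, dom_app]
    exact hn _ _ (h₁ k ((le_max_left _ _).trans hk) ρ' h)
      (h₂ k ((le_max_right _ _).trans hk) ρ' h)

theorem eval_mono {ρ ρ' : ℕ → Dom} (h : ∀ x, ρ x ≤ ρ' x) (M : CL Dom) :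
    M.eval domLTS.toQATS ρ ≤ M.eval domLTS.toQATS ρ' := by
  intro m
  obtain ⟨n, hn⟩ := eval_cont ρ M m
  exact hn n le_rfl ρ' fun x => proj_mono n (h x)

/-- The `n`-th approximation of an environment. -/
def approxEnv (ρ : ℕ → Dom) (n : ℕ) : ℕ → Dom := fun x => emb n (proj n (ρ x))

theorem interp_approxEnv_le (ρ : ℕ → Dom) (n : ℕ) (M : PureLam) :
    domLTS.interp (approxEnv ρ n) M ≤ domLTS.interp ρ M :=
  eval_mono (fun x => emb_proj_le n (ρ x)) _

open Filter in
theorem sat_interp_approxEnv {ρ : ℕ → Dom} {M : PureLam} {φ : Fml}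
    (h : domLTS.Sat (domLTS.interp ρ M) φ) :
    ∀ᶠ n in atTop, domLTS.Sat (domLTS.interp (approxEnv ρ n) M) φ := by
  obtain ⟨m, hm⟩ := dom_sat_open h
  obtain ⟨n, hn⟩ := eval_cont ρ (M.toCL domLTS.k domLTS.s) m
  filter_upwards [eventually_ge_atTop n] with k hk
  exact hm _ (hn k hk _ fun x => (conn_self k _).symm.le)

theorem isCompactElement_emb (n : ℕ) (d : Approx n) : IsCompactElement (emb n d) := by
  intro S u hne hS hu hle
  obtain ⟨s, hs, h⟩ := proj_of_isLUB hne hS hu n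
  exact ⟨s, hs, emb_le_iff.2 ((emb_le_iff.1 hle).trans h.le)⟩

namespace LTS

variable {A : Type*} {𝒜 : LTS A}

open Filter in
/-- The failure of a conditional formula in `D` is observed at a compact environment: convergence
and satisfaction are continuous, and divergence is inherited by smaller elements. -/
theorem fullyAbstract_of_embedding (hA : 𝒜.Approximable) {t : A → Dom} (ht : 𝒜.IsMorphism t)
    (he : 𝒜.IsCombinatoryEmbedding t) (hK : {d | IsCompactElement d} ⊆ Set.range t) :
    𝒜.FullyAbstract := by
  have hint : ∀ (ρ : ℕ → A) M, domLTS.interp (fun x => t (ρ x)) M = t (𝒜.interp ρ M) :=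
    interp_map he.map_app he.map_k he.map_s
  have hconv : ∀ (ρ : ℕ → A) M,
      𝒜.Conv (𝒜.interp ρ M) ↔ domLTS.Conv (domLTS.interp (fun x => t (ρ x)) M) := fun ρ M => by
    rw [hint, ht.conv_iff]
  have hle : ∀ (ρ : ℕ → A) M N, 𝒜.Le (𝒜.interp ρ M) (𝒜.interp ρ N) ↔
      domLTS.interp (fun x => t (ρ x)) M ≤ domLTS.interp (fun x => t (ρ x)) N := fun ρ M N => by
    rw [hint, hint, ht.le_iff hA]
  refine Set.ext fun F => ⟨fun hF ρ h₁ h₂ => ?_, fun hF ρ h₁ h₂ => ?_⟩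
  · have hρ : ∀ n, ∃ ρ' : ℕ → A, (fun x => t (ρ' x)) = approxEnv ρ n := fun n => by
      choose ρ' hρ' using fun x => hK (isCompactElement_emb n (proj n (ρ x)))
      exact ⟨ρ', funext hρ'⟩
    choose ρ' hρ' using hρ
    -- the formula is valid in `𝒜` at all sufficiently fine approximations of `ρ`
    have hev : ∀ᶠ n in atTop, 𝒜.SatAtomic (ρ' n) F.concl := by
      have h₃ : ∀ᶠ n in atTop, ∀ M ∈ F.convs, domLTS.Conv (domLTS.interp (approxEnv ρ n) M) := by
        refine (eventually_all_finite (List.finite_toSet F.convs)).2 fun M hM => ?_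
        exact (sat_interp_approxEnv (QATS.sat_lam.2 (h₁ M hM))).mono fun n => QATS.sat_lam.1
      filter_upwards [h₃] with n hn
      refine hF (ρ' n) (fun M hM => ?_) fun N hN hc => h₂ N hN ?_
      · rw [hconv, hρ']
        exact hn M hM
      · rw [hconv, hρ'] at hc
        exact (dom_le_of_le (interp_approxEnv_le ρ n N)).conv hc
    have hle' : ∀ M N, (∀ᶠ n in atTop, 𝒜.Le (𝒜.interp (ρ' n) M) (𝒜.interp (ρ' n) N)) →
        domLTS.Le (domLTS.interp ρ M) (domLTS.interp ρ N) := fun M N hev => by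
      refine dom_le_iff.2 (dom_le_iff_sat.2 fun φ hφ => ?_)
      obtain ⟨n, hn, hn'⟩ := (hev.and (sat_interp_approxEnv hφ)).exists
      rw [hle, hρ'] at hn
      exact hn'.mono (dom_le_of_le (hn.trans (interp_approxEnv_le ρ n N)))
    cases hc : F.concl with
    | le M N =>
      rw [hc] at hev
      exact hle' M N hev
    | eq M N =>
      rw [hc] at hev
      exact ⟨hle' M N (hev.mono fun n hn => hn.1), hle' N M (hev.mono fun n hn => hn.2)⟩
    | conv M =>
      rw [hc] at hev
      obtain ⟨n, hn⟩ := hev.exists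
      have hn := (hconv _ M).1 hn
      rw [hρ'] at hn
      exact (dom_le_of_le (interp_approxEnv_le ρ n M)).conv hn
    | div M =>
      rw [hc] at hev
      intro hM
      obtain ⟨n, hn, hn'⟩ := (hev.and (sat_interp_approxEnv (QATS.sat_lam.2 hM))).exists
      rw [QATS.sat_lam, ← hρ'] at hn'
      exact hn ((hconv _ M).2 hn')
  · have hD := hF (fun x => t (ρ x)) (fun M hM => (hconv ρ M).1 (h₁ M hM))
      fun N hN hc => h₂ N hN ((hconv ρ N).2 hc)
    cases hc : F.concl with
    | le M N =>
      rw [hc] at hD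
      exact (hle ρ M N).2 (dom_le_iff.1 hD)
    | eq M N =>
      rw [hc] at hD
      exact ⟨(hle ρ M N).2 (dom_le_iff.1 hD.1), (hle ρ N M).2 (dom_le_iff.1 hD.2)⟩
    | conv M =>
      rw [hc] at hD
      exact (hconv ρ M).2 hD
    | div M =>
      rw [hc] at hD
      exact fun hM => hD ((hconv ρ M).1 hM)

end LTS

/-! ### The equivalence of the five conditions -/

/-- The divergent term `(λx. x x) (λx. x x)`. -/
def omega : PureLam :=
  .app (.lam 0 (.app (.var 0) (.var 0))) (.lam 0 (.app (.var 0) (.var 0)))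

theorem not_eval_omega {M V : PureLam} (h : Lam.Eval M V) : M ≠ omega := by
  induction h with
  | lam => simp [omega]
  | app h₁ _ _ ih =>
    rintro ⟨rfl, rfl⟩
    cases h₁
    exact ih rfl

namespace LTS

variable {A : Type*} {𝒜 : LTS A}

theorem Sensible.exists_div (h : 𝒜.Sensible) : ∃ o, 𝒜.Div o := by
  by_contra hno
  simp only [QATS.Div, not_exists, not_not] at hno
  obtain ⟨V, hV⟩ := (h omega (by decide)).1 fun _ => hno _
  exact not_eval_omega hV rfl

theorem tfae_of_isLTS (h : 𝒜.IsLTS) (hS : 𝒜.Sensible) (hA : 𝒜.Approximable)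
    (hC : 𝒜.ConvTestDefinable) : List.TFAE [𝒜.ParConvDefinable, 𝒜.Expressive, 𝒜.Complete,
      ∃ t : A → Dom, 𝒜.IsCanonicalMap t ∧ 𝒜.IsCombinatoryEmbedding t ∧
        {d | IsCompactElement d} ⊆ Set.range t, 𝒜.FullyAbstract] := by
  obtain ⟨o, ho⟩ := hS.exists_div
  tfae_have 1 → 2 := fun hP => expressive_of_parConv h hC hP ho
  tfae_have 2 → 1 := parConv_of_expressive h hA hC
  tfae_have 1 → 3 := fun hP => complete_of_expressive h hA (expressive_of_parConv h hC hP ho)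
    (testable_of_parConv h hC hP ho)
  tfae_have 3 → 1 := parConv_of_complete h hC
  tfae_have 1 → 4 := fun hP => exists_embedding h hA (expressive_of_parConv h hC hP ho)
    (testable_of_parConv h hC hP ho)
  tfae_have 4 → 5 := fun ⟨_, ht, he, hK⟩ => fullyAbstract_of_embedding hA ht.1 he hK
  tfae_have 5 → 1 := parConv_of_fullyAbstract h hC
  tfae_finish

end LTS

/-! ### Evaluation in the language with parallel convergence -/

namespace PLam

open Lam

theorem Eval.self {M V : PLam} (h : Eval M V) : Eval V V := by
  induction h with
  | lam x M => exact .lam x M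
  | beta _ _ _ ih => exact ih
  | par => exact .par
  | par₁ _ _ => exact .par₁ .par
  | left _ _ _ _ => exact .lam _ _
  | right _ _ _ _ => exact .lam _ _

/-- Once its head has been evaluated, an application evaluates like the value applied to the
argument. -/
theorem eval_app_iff {M N V W : PLam} (h : Eval M V) :
    Eval (app M N) W ↔ Eval (applyVal V N) W := by
  constructor
  · intro h'
    cases h' with
    | beta h₁ h₂ => rwa [h.unique h₁]
    | par₁ h₁ => rw [h.unique h₁]; exact .par₁ .par
    | left h₁ h₂ => rw [h.unique h₁]; exact .left (.par₁ .par) h₂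
    | right h₁ h₂ => rw [h.unique h₁]; exact .right (.par₁ .par) h₂
  · intro h'
    have key : Eval (app V N) W → Eval (app M N) W := fun h' => by
      cases h' with
      | beta h₁ h₂ => exact .beta (h.self.unique h₁ ▸ h) h₂
      | par₁ h₁ => exact .par₁ (h.self.unique h₁ ▸ h)
      | left h₁ h₂ => exact .left (h.self.unique h₁ ▸ h) h₂
      | right h₁ h₂ => exact .right (h.self.unique h₁ ▸ h) h₂
    cases V with
    | lam x B => exact .beta h h'
    | var x => exact key h'
    | const c => exact key h'
    | app V₁ V₂ => exact key h'

theorem ellP_ev {M : Closed} {V : PLam} (h : Eval M.1 V) :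
    ellP.ev M = some fun N => ⟨applyVal V N.1, applyVal_closed (h.closed M.2) N.2⟩ := by
  have hex : ∃ V, Eval M.1 V := ⟨V, h⟩
  have hch : hex.choose = V := hex.choose_spec.unique h
  simp only [ellP, dif_pos hex, hch]

theorem ellP_conv {M : Closed} : ellP.Conv M ↔ ∃ V, Eval M.1 V := by
  constructor
  · rintro ⟨f, hf⟩
    by_contra hex
    simp [ellP, hex] at hf
  · rintro ⟨V, hV⟩
    exact ⟨_, ellP_ev hV⟩

theorem ellP_app {M : Closed} {V : PLam} (h : Eval M.1 V) (N : Closed) :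
    (ellP.app M N).1 = applyVal V N.1 := by
  rw [QATS.app_of_ev (ellP_ev h)]

/-- Closed terms with the same evaluations are bisimilar. -/
theorem ellP_le_of_eval {M N : Closed} (h : ∀ V, Eval M.1 V → Eval N.1 V) : ellP.Le M N := by
  refine QATS.le_of_app fun hM => ?_
  obtain ⟨V, hV⟩ := ellP_conv.1 hM
  refine ⟨ellP_conv.2 ⟨V, h V hV⟩, fun c => ?_⟩
  rw [show ellP.app M c = ellP.app N c from
    Subtype.ext ((ellP_app hV c).trans (ellP_app (h V hV) c).symm)]
  exact .refl _

/-- The application of closed terms. -/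
def appC (M N : Closed) : Closed := ⟨app M.1 N.1, by simp [fv, M.2, N.2]⟩

theorem ellP_app_le (M N : Closed) : ellP.Le (ellP.app M N) (appC M N) := by
  by_cases hM : ellP.Conv M
  · obtain ⟨V, hV⟩ := ellP_conv.1 hM
    refine ellP_le_of_eval fun W hW => (eval_app_iff hV).2 ?_
    rwa [ellP_app hV] at hW
  · exact QATS.Div.le (QATS.Div.app' hM N) _

/-! ### Denotations in the domain -/

/-- The translation into combinatory terms over `D`; the constant `P` denotes parallel
convergence. -/
noncomputable def toCL : PLam → CL Dom
  | var x => .var x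
  | const _ => .const domPar
  | app M N => .app (toCL M) (toCL N)
  | lam x M => CL.bracket domK domS x (toCL M)

theorem fv_toCL (M : PLam) : (toCL M).fv = M.fv := by
  induction M with
  | var x => rfl
  | const c => rfl
  | app M N ih₁ ih₂ => simp [toCL, CL.fv, fv, ih₁, ih₂]
  | lam x M ih => simp [toCL, CL.fv_bracket, fv, ih]

/-- The denotation of a term in `D`. -/
noncomputable def den (ρ : ℕ → Dom) (M : PLam) : Dom := (toCL M).eval domLTS.toQATS ρ

theorem den_congr {ρ ρ' : ℕ → Dom} {M : PLam} (h : ∀ x ∈ M.fv, ρ x = ρ' x) :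
    den ρ M = den ρ' M := CL.eval_congr _ _ (by rwa [fv_toCL])

theorem den_closed {M : PLam} (hM : M.fv = ∅) (ρ ρ' : ℕ → Dom) : den ρ M = den ρ' M :=
  den_congr (by simp [hM])

theorem den_app (ρ : ℕ → Dom) (M N : PLam) : den ρ (app M N) = domApp (den ρ M) (den ρ N) :=
  dom_app _ _

theorem den_lam_ne_bot (ρ : ℕ → Dom) (x : ℕ) (M : PLam) : den ρ (lam x M) ≠ ⊥ :=
  dom_conv.1 (dom_isLTS.conv_bracket ρ x (toCL M))

theorem domApp_den_lam (ρ : ℕ → Dom) (x : ℕ) (M : PLam) (d : Dom) :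
    domApp (den ρ (lam x M)) d = den (Function.update ρ x d) M := by
  rw [← dom_app]
  exact dom_equiv_iff.1 (dom_isLTS.bracket_app ρ x (toCL M) d)

theorem den_subst (x : ℕ) {N : PLam} (hN : N.fv = ∅) (M : PLam) (ρ : ℕ → Dom) :
    den ρ (subst x N M) = den (Function.update ρ x (den ρ N)) M := by
  induction M generalizing ρ with
  | var y =>
    by_cases hy : y = x
    · subst hy
      simp [subst, den, toCL, CL.eval]
    · simp [subst, hy, den, toCL, CL.eval]
  | const c => rfl
  | app M M' ih₁ ih₂ => simp only [subst, den_app, ih₁, ih₂]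
  | lam y M ih =>
    by_cases hy : y = x
    · subst hy
      simp only [subst, if_true]
      refine den_congr fun z hz => (Function.update_of_ne (?_ : z ≠ y) _ _).symm
      simp only [fv, Finset.mem_sdiff, Finset.mem_singleton] at hz
      exact hz.2
    · simp only [subst, hy, if_false]
      refine dom_ext (den_lam_ne_bot _ _ _) (den_lam_ne_bot _ _ _) fun d => ?_
      rw [domApp_den_lam, domApp_den_lam, ih, Function.update_comm (Ne.symm hy),
        den_closed hN (Function.update ρ y d) ρ]

theorem den_I (ρ : ℕ → Dom) : den ρ I = domI :=
  dom_ext (den_lam_ne_bot _ _ _) domI_ne_bot fun d => by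
    rw [I, domApp_den_lam, domI_app]
    exact Function.update_self 0 d ρ

theorem den_applyVal {V N : PLam} (hN : N.fv = ∅) (ρ : ℕ → Dom) :
    den ρ (applyVal V N) = domApp (den ρ V) (den ρ N) := by
  cases V with
  | lam x B => rw [applyVal, den_subst x hN, domApp_den_lam]
  | var x => exact den_app _ _ _
  | const c => exact den_app _ _ _
  | app V₁ V₂ => exact den_app _ _ _

theorem Eval.den_eq {M V : PLam} (h : Eval M V) (hM : M.fv = ∅) (ρ : ℕ → Dom) :
    den ρ M = den ρ V ∧ den ρ V ≠ ⊥ := by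
  induction h with
  | lam x M => exact ⟨rfl, den_lam_ne_bot _ _ _⟩
  | @beta M N x B Q h₁ h₂ ih₁ ih₂ =>
    simp only [fv, Finset.union_eq_empty] at hM
    have ih := ih₂ (by rw [fv_subst _ hM.2]; exact h₁.closed hM.1)
    refine ⟨?_, ih.2⟩
    rw [← ih.1, den_app, (ih₁ hM.1).1, domApp_den_lam, den_subst x hM.2]
  | par => exact ⟨rfl, domPar_ne_bot⟩
  | par₁ h ih =>
    simp only [fv, Finset.union_eq_empty] at hM
    rw [den_app, den_app, (ih hM.1).1]
    exact ⟨rfl, domPar_app_ne_bot _⟩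
  | left h₁ h₂ ih₁ ih₂ =>
    simp only [fv, Finset.union_eq_empty] at hM
    have hM' := h₁.closed hM.1
    simp only [fv, Finset.union_eq_empty] at hM'
    have ih := ih₂ hM'.2
    rw [den_app, (ih₁ hM.1).1, den_app, den_I]
    exact ⟨domPar_app_of_ne (.inl (ih.1 ▸ ih.2)), domI_ne_bot⟩
  | right h₁ h₂ ih₁ ih₂ =>
    simp only [fv, Finset.union_eq_empty] at hM
    have ih := ih₂ hM.2
    rw [den_app, (ih₁ hM.1).1, den_app, den_I]
    exact ⟨domPar_app_of_ne (.inr (ih.1 ▸ ih.2)), domI_ne_bot⟩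

/-- The denotation of a closed term. -/
noncomputable def denC (M : Closed) : Dom := den (fun _ => ⊥) M.1

/-! ### Simultaneous substitution of closed terms -/

/-- Simultaneous substitution; it is only used for closed terms and variables that are mapped to
themselves, so that no variable can be captured. -/
def msubst (σ : ℕ → PLam) : PLam → PLam
  | var x => σ x
  | const c => const c
  | app M N => app (msubst σ M) (msubst σ N)
  | lam x M => lam x (msubst (Function.update σ x (var x)) M)

theorem subst_of_notMem {x : ℕ} {N M : PLam} (h : x ∉ M.fv) : subst x N M = M := by
  induction M with
  | var y =>
    have hy : y ≠ x := fun e => h (by simp [fv, e])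
    simp [subst, hy]
  | const c => rfl
  | app M M' ih₁ ih₂ =>
    simp only [fv, Finset.mem_union, not_or] at h
    simp only [subst, ih₁ h.1, ih₂ h.2]
  | lam y M ih =>
    by_cases hy : y = x
    · simp [subst, hy]
    · have : x ∉ M.fv := fun hx => h (by simp [fv, hx, Ne.symm hy])
      simp [subst, hy, ih this]

theorem subst_msubst {x : ℕ} {N : PLam} (M : PLam) {τ : ℕ → PLam} (hx : τ x = var x)
    (hτ : ∀ y, (τ y).fv = ∅ ∨ τ y = var y) :
    subst x N (msubst τ M) = msubst (Function.update τ x N) M := by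
  induction M generalizing τ with
  | var y =>
    by_cases hy : y = x
    · subst hy
      simp [msubst, hx, subst]
    · simp only [msubst, Function.update_of_ne hy]
      rcases hτ y with h | h
      · exact subst_of_notMem (by simp [h])
      · simp [h, subst, hy]
  | const c => rfl
  | app M M' ih₁ ih₂ => simp only [msubst, subst, ih₁ hx hτ, ih₂ hx hτ]
  | lam y M ih =>
    by_cases hy : y = x
    · subst hy
      simp [msubst, subst]
    · simp only [msubst, subst, hy, if_false]
      rw [ih, Function.update_comm (Ne.symm hy)]
      · rw [Function.update_of_ne (Ne.symm hy), hx]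
      · intro z
        by_cases hz : z = y
        · subst hz; simp
        · simpa [hz] using hτ z

theorem fv_msubst_subset {σ : ℕ → PLam} {S : Finset ℕ} (M : PLam) (h : ∀ y, (σ y).fv ⊆ S) :
    (msubst σ M).fv ⊆ S := by
  induction M generalizing σ S with
  | var x => exact h x
  | const c => simp [msubst, fv]
  | app M N ih₁ ih₂ => exact Finset.union_subset (ih₁ h) (ih₂ h)
  | lam x M ih =>
    have := ih (σ := Function.update σ x (var x)) (S := insert x S) fun y => by
      by_cases hy : y = x
      · subst hy; simp [fv]
      · rw [Function.update_of_ne hy]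
        exact (h y).trans (Finset.subset_insert _ _)
    intro z hz
    simp only [msubst, fv, Finset.mem_sdiff, Finset.mem_singleton] at hz
    exact (Finset.mem_insert.1 (this hz.1)).resolve_left hz.2

theorem msubst_eq_self {σ : ℕ → PLam} (M : PLam) (h : ∀ y ∈ M.fv, σ y = var y) :
    msubst σ M = M := by
  induction M generalizing σ with
  | var x => exact h x (by simp [fv])
  | const c => rfl
  | app M N ih₁ ih₂ =>
    rw [msubst, ih₁ fun y hy => h y (by simp [fv, hy]), ih₂ fun y hy => h y (by simp [fv, hy])]
  | lam x M ih =>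
    rw [msubst, ih]
    intro y hy
    by_cases hyx : y = x
    · subst hyx; simp
    · rw [Function.update_of_ne hyx]
      exact h y (by simp [fv, hy, hyx])

/-- The closed instance of a term under an assignment of closed terms to the variables. -/
def inst (σ : ℕ → Closed) (M : PLam) : Closed :=
  ⟨msubst (fun x => (σ x).1) M,
    Finset.subset_empty.1 (fv_msubst_subset M fun y => (σ y).2.subset)⟩

theorem inst_closed (σ : ℕ → Closed) (M : Closed) : inst σ M.1 = M :=
  Subtype.ext (msubst_eq_self _ fun y hy => by simp [M.2] at hy)

theorem ellP_app_inst_lam (σ : ℕ → Closed) (x : ℕ) (M : PLam) (N : Closed) :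
    ellP.app (inst σ (lam x M)) N = inst (Function.update σ x N) M := by
  refine Subtype.ext ((ellP_app (M := inst σ (lam x M)) (.lam _ _) N).trans ?_)
  rw [applyVal, subst_msubst _ (Function.update_self _ _ _) fun y => ?_, Function.update_idem]
  · refine congrArg (msubst · M) (funext fun y => ?_)
    by_cases hy : y = x
    · subst hy; simp
    · simp [hy]
  · by_cases hy : y = x
    · subst hy; simp
    · left
      rw [Function.update_of_ne hy]
      exact (σ y).2

/-! ### Adequacy -/

/-- What `⊥` satisfies is derivable from `t`, and so it holds everywhere. -/
theorem sat_of_sat_bot {A : Type*} {𝒜 : QATS A} {φ : Fml} (h : domLTS.Sat ⊥ φ) (a : A) :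
    𝒜.Sat a φ :=
  QATS.Sat.entails (sat_least.1 (h.mono (dom_le_of_le bot_le)) : Fml.Entails .top φ) trivial

/-- The closed term `I`. -/
def IC : Closed := ⟨I, by decide⟩

/-- The closed term `P`. -/
def PC : Closed := ⟨P, rfl⟩

theorem sat_I {φ : Fml} (h : domLTS.Sat domI φ) : ellP.Sat IC φ := by
  induction φ with
  | top => trivial
  | and φ ψ ih₁ ih₂ => exact ⟨ih₁ h.1, ih₂ h.2⟩
  | arrow φ ψ =>
    refine QATS.sat_arrow.2 ⟨ellP_conv.2 ⟨_, .lam _ _⟩, fun N hN => ?_⟩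
    have h₂ := (dom_sat_arrow.1 h).2
    rw [domI_app, sat_least] at h₂
    rw [show ellP.app IC N = N from Subtype.ext ((ellP_app (M := IC) (.lam _ _) N).trans
      (by simp [applyVal, subst]))]
    exact hN.entails h₂

theorem eval_of_least {φ : Fml} {N : Closed} (hN : ellP.Sat N φ) (h : least φ ≠ ⊥) :
    ∃ V, Eval N.1 V :=
  ellP_conv.1 (QATS.sat_lam.1 (hN.entails (sat_least.1 (QATS.sat_lam.2 (dom_conv.2 h)))))

/-- The operational behaviour of the constant `P` is at least that of its denotation: when `P` is
applied to two arguments, the convergence of either least satisfier is inherited by the term. -/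
theorem sat_P {φ : Fml} (h : domLTS.Sat domPar φ) : ellP.Sat PC φ := by
  have h₀ : ∀ N : Closed, Eval (appC PC N).1 (appC PC N).1 := fun N => .par₁ .par
  have h₁ : ∀ N : Closed, ellP.app PC N = appC PC N := fun N =>
    Subtype.ext (ellP_app (M := PC) .par N)
  have h₂ : ∀ N N' : Closed, ellP.app (appC PC N) N' = appC (appC PC N) N' := fun N N' =>
    Subtype.ext (ellP_app (h₀ N) N')
  have key : ∀ {φ ψ : Fml} {N : Closed}, ellP.Sat N φ →
      domLTS.Sat (domApp domPar (least φ)) ψ → ellP.Sat (appC PC N) ψ := by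
    intro φ ψ N hN h
    induction ψ with
    | top => trivial
    | and ψ₁ ψ₂ ih₁ ih₂ => exact ⟨ih₁ h.1, ih₂ h.2⟩
    | arrow φ' ψ =>
      refine QATS.sat_arrow.2 ⟨ellP_conv.2 ⟨_, h₀ N⟩, fun N' hN' => ?_⟩
      have h₃ := (dom_sat_arrow.1 h).2
      rw [h₂]
      by_cases hc : least φ ≠ ⊥ ∨ least φ' ≠ ⊥
      · rw [domPar_app_of_ne hc] at h₃
        have hev : Eval (appC (appC PC N) N').1 I := by
          rcases hc with hc | hc
          · obtain ⟨V, hV⟩ := eval_of_least hN hc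
            exact .left (h₀ N) hV
          · obtain ⟨V, hV⟩ := eval_of_least hN' hc
            exact .right (h₀ N) hV
        refine (sat_I h₃).mono (ellP_le_of_eval fun W hW => ?_)
        rwa [hW.unique hev.self]
      · rw [domPar_app_app, guard_neg hc] at h₃
        exact sat_of_sat_bot h₃ _
  induction φ with
  | top => trivial
  | and φ ψ ih₁ ih₂ => exact ⟨ih₁ h.1, ih₂ h.2⟩
  | arrow φ ψ =>
    refine QATS.sat_arrow.2 ⟨ellP_conv.2 ⟨_, .par⟩, fun N hN => ?_⟩
    rw [h₁]
    exact key hN (dom_sat_arrow.1 h).2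

/-- Adequacy of the denotational semantics: a logical relation between elements of `D` and closed
terms, given by inclusion of the sets of satisfied formulae, is preserved by all terms. -/
theorem sat_inst (M : PLam) {ρ : ℕ → Dom} {σ : ℕ → Closed}
    (h : ∀ x φ, domLTS.Sat (ρ x) φ → ellP.Sat (σ x) φ) {φ : Fml} (hM : domLTS.Sat (den ρ M) φ) :
    ellP.Sat (inst σ M) φ := by
  induction M generalizing ρ σ φ with
  | var x => exact h x φ hM
  | const c => exact sat_P hM
  | app M N ihM ihN =>
    rw [den_app] at hM
    by_cases hbot : den ρ M = ⊥
    · rw [hbot, domApp_bot] at hM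
      exact sat_of_sat_bot hM _
    · obtain ⟨ψ, h₁, h₂⟩ := dom_exists_sat_arrow hbot hM
      exact ((QATS.sat_arrow.1 (ihM h h₁)).2 _ (ihN h h₂)).mono (ellP_app_le _ _)
  | lam x M ih =>
    induction φ with
    | top => trivial
    | and φ ψ ih₁ ih₂ => exact ⟨ih₁ hM.1, ih₂ hM.2⟩
    | arrow φ ψ =>
      refine QATS.sat_arrow.2 ⟨ellP_conv.2 ⟨_, .lam _ _⟩, fun N hN => ?_⟩
      have hM := (dom_sat_arrow.1 hM).2
      rw [domApp_den_lam] at hM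
      rw [ellP_app_inst_lam]
      refine ih (fun y θ hy => ?_) hM
      by_cases hyx : y = x
      · subst hyx
        rw [Function.update_self] at hy ⊢
        exact hN.entails (sat_least.1 hy)
      · rw [Function.update_of_ne hyx] at hy ⊢
        exact h y θ hy

theorem sat_of_sat_denC {M : Closed} {φ : Fml} (h : domLTS.Sat (denC M) φ) : ellP.Sat M φ := by
  have := sat_inst M.1 (σ := fun _ => IC) (fun _ _ hx => sat_of_sat_bot hx _) h
  rwa [inst_closed] at this

theorem conv_iff_denC {M : Closed} : ellP.Conv M ↔ denC M ≠ ⊥ := by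
  constructor
  · intro h
    obtain ⟨V, hV⟩ := ellP_conv.1 h
    have := hV.den_eq M.2 fun _ => ⊥
    exact this.1.trans_ne this.2
  · exact fun h => QATS.sat_lam.1 (sat_of_sat_denC (QATS.sat_lam.2 (dom_conv.2 h)))

theorem denC_app (M N : Closed) : denC (ellP.app M N) = domApp (denC M) (denC N) := by
  by_cases hM : ellP.Conv M
  · obtain ⟨V, hV⟩ := ellP_conv.1 hM
    rw [denC, ellP_app hV, den_applyVal N.2, ← (hV.den_eq M.2 _).1]
    rfl
  · have hbot : denC M = ⊥ := by
      by_contra h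
      exact hM (conv_iff_denC.2 h)
    rw [QATS.Div.app hM, hbot, domApp_bot]

theorem denC_k : denC ellP.k = domK := by
  refine dom_ext (den_lam_ne_bot _ _ _) (dom_conv.1 dom_isLTS.k_conv) fun x => ?_
  rw [denC, ellP, domApp_den_lam]
  refine dom_ext (den_lam_ne_bot _ _ _) ?_ fun y => ?_
  · rw [← dom_app]
    exact dom_conv.1 (dom_isLTS.k_conv₁ x)
  · rw [domApp_den_lam, domK_app]
    rfl

theorem denC_s : denC ellP.s = domS := by
  refine dom_ext (den_lam_ne_bot _ _ _) (dom_conv.1 dom_isLTS.s_conv) fun x => ?_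
  rw [denC, ellP, domApp_den_lam]
  refine dom_ext (den_lam_ne_bot _ _ _) ?_ fun y => ?_
  · rw [← dom_app]
    exact dom_conv.1 (dom_isLTS.s_conv₁ x)
  rw [domApp_den_lam]
  refine dom_ext (den_lam_ne_bot _ _ _) ?_ fun z => ?_
  · rw [← dom_app, ← dom_app]
    exact dom_conv.1 (dom_isLTS.s_conv₂ x y)
  · rw [domApp_den_lam, domS_app]
    simp [den, toCL, CL.eval, dom_app]

/-- Inclusion of denotations is a bisimulation, by adequacy. -/
theorem le_of_denC_le {M N : Closed} (h : denC M ≤ denC N) : ellP.Le M N := by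
  refine ⟨fun M N => denC M ≤ denC N, fun M N h f hf => ?_, h⟩
  have hM := conv_iff_denC.1 ⟨f, hf⟩
  obtain ⟨g, hg⟩ := conv_iff_denC.2 fun hN : denC N = ⊥ => hM (le_bot_iff.1 (h.trans hN.le))
  refine ⟨g, hg, fun c => ?_⟩
  rw [← QATS.app_of_ev hf, ← QATS.app_of_ev hg]
  show denC (ellP.app M c) ≤ denC (ellP.app N c)
  rw [denC_app, denC_app]
  exact domApp_mono h le_rfl

theorem equiv_of_denC_eq {M N : Closed} (h : denC M = denC N) : ellP.Equiv M N :=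
  ⟨le_of_denC_le h.le, le_of_denC_le h.ge⟩

/-! ### The language with parallel convergence as a lambda transition system -/

theorem ellP_approximable : ellP.Approximable := by
  intro M Ns h
  have hden : ∀ (Ns : List Closed) (M : Closed),
      denC (Ns.foldl ellP.app M) = (Ns.map denC).foldl domLTS.app (denC M) := by
    intro Ns
    induction Ns with
    | nil => exact fun _ => rfl
    | cons N Ns ih =>
      intro M
      rw [List.foldl_cons, ih, denC_app, List.map_cons, List.foldl_cons, dom_app]
  rw [conv_iff_denC, hden, ← dom_conv] at h
  obtain ⟨φs, h₁, h₂⟩ := dom_approximable _ _ h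
  rw [List.forall₂_map_left_iff] at h₁
  exact ⟨φs, h₁.imp fun _ _ => sat_of_sat_denC, sat_of_sat_denC h₂⟩

theorem ellP_isLTS : ellP.IsLTS where
  isATS := ellP_approximable.isATS
  k_conv := ellP_conv.2 ⟨_, .lam _ _⟩
  k_conv₁ x := by
    rw [conv_iff_denC, denC_app, denC_k, ← dom_app, ← dom_conv]
    exact dom_isLTS.k_conv₁ _
  k_app x y := equiv_of_denC_eq (by rw [denC_app, denC_app, denC_k, domK_app])
  s_conv := ellP_conv.2 ⟨_, .lam _ _⟩
  s_conv₁ x := by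
    rw [conv_iff_denC, denC_app, denC_s, ← dom_app, ← dom_conv]
    exact dom_isLTS.s_conv₁ _
  s_conv₂ x y := by
    rw [conv_iff_denC, denC_app, denC_app, denC_s, ← dom_app, ← dom_app, ← dom_conv]
    exact dom_isLTS.s_conv₂ _ _
  s_app x y z := equiv_of_denC_eq (by simp only [denC_app, denC_s, domS_app])

theorem denC_interp (ρ : ℕ → Closed) (M : PureLam) :
    denC (ellP.interp ρ M) = domLTS.interp (fun x => denC (ρ x)) M :=
  (LTS.interp_map (fun a b => (denC_app a b).trans (dom_app _ _).symm) denC_k denC_s ρ M).symm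

/-- The inclusion of the pure terms. -/
def ofPure : PureLam → PLam
  | var x => var x
  | const c => c.elim
  | app M N => app (ofPure M) (ofPure N)
  | lam x M => lam x (ofPure M)

theorem fv_ofPure (M : PureLam) : (ofPure M).fv = M.fv := by
  induction M with
  | var x => rfl
  | const c => exact c.elim
  | app M N ih₁ ih₂ => simp only [ofPure, fv, ih₁, ih₂]
  | lam x M ih => simp only [ofPure, fv, ih]

theorem ofPure_subst (x : ℕ) (N M : PureLam) :
    ofPure (subst x N M) = subst x (ofPure N) (ofPure M) := by
  induction M with
  | var y => by_cases hy : y = x <;> simp [subst, ofPure, hy]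
  | const c => exact c.elim
  | app M M' ih₁ ih₂ => simp only [ofPure, subst, ih₁, ih₂]
  | lam y M ih => by_cases hy : y = x <;> simp [subst, ofPure, hy, ih]

theorem toCL_ofPure (M : PureLam) : toCL (ofPure M) = M.toCL domK domS := by
  induction M with
  | var x => rfl
  | const c => exact c.elim
  | app M N ih₁ ih₂ => simp only [ofPure, toCL, Lam.toCL, ih₁, ih₂]
  | lam x M ih => simp only [ofPure, toCL, Lam.toCL, ih]

theorem eval_ofPure {M V : PureLam} (h : Lam.Eval M V) : Eval (ofPure M) (ofPure V) := by
  induction h with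
  | lam x M => exact .lam _ _
  | app _ _ ih₁ ih₂ =>
    rw [ofPure_subst] at ih₂
    exact .beta ih₁ ih₂

/-- Evaluation of a pure term in the extended language stays within the pure terms. -/
theorem eval_of_eval_ofPure {M' V' : PLam} (h : Eval M' V') :
    ∀ M, M' = ofPure M → ∃ V, V' = ofPure V ∧ Lam.Eval M V := by
  -- an evaluation to `P` or `P N` would start from a term with `P` in head position
  have hP : ∀ M, P ≠ ofPure M := fun M => by
    cases M with
    | const c => exact c.elim
    | _ => simp [P, ofPure]
  have hPN : ∀ N M, app P N ≠ ofPure M := fun N M => by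
    cases M with
    | const c => exact c.elim
    | app M₁ M₂ =>
      intro h
      exact hP M₁ (Lam.app.inj h).1
    | _ => simp [ofPure]
  induction h with
  | lam x B =>
    intro M hM
    cases M with
    | const c => exact c.elim
    | lam y N => exact ⟨_, hM, .lam _ _⟩
    | _ => simp [ofPure] at hM
  | @beta M₁ N₁ x B Q _ _ ih₁ ih₂ =>
    intro M hM
    cases M with
    | const c => exact c.elim
    | app M N =>
      obtain ⟨rfl, rfl⟩ := Lam.app.inj hM
      obtain ⟨V, hV, hMV⟩ := ih₁ M rfl
      cases V with
      | const c => exact c.elim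
      | lam y C =>
        obtain ⟨rfl, rfl⟩ := Lam.lam.inj hV
        obtain ⟨W, hW, hCW⟩ := ih₂ (subst x N C) (ofPure_subst x N C).symm
        exact ⟨W, hW, .app hMV hCW⟩
      | _ => simp [ofPure] at hV
    | _ => simp [ofPure] at hM
  | par => exact fun M hM => absurd hM (hP M)
  | par₁ _ ih =>
    intro M hM
    cases M with
    | const c => exact c.elim
    | app M N =>
      obtain ⟨V, hV, -⟩ := ih M (Lam.app.inj hM).1
      exact absurd hV (hP V)
    | _ => simp [ofPure] at hM
  | left _ _ ih _ | right _ _ ih _ =>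
    intro M hM
    cases M with
    | const c => exact c.elim
    | app M N =>
      obtain ⟨V, hV, -⟩ := ih M (Lam.app.inj hM).1
      exact absurd hV (hPN _ V)
    | _ => simp [ofPure] at hM

theorem ellP_sensible : ellP.Sensible := by
  intro M hM
  have hc : (ofPure M).fv = ∅ := (fv_ofPure M).trans hM
  obtain ⟨N, hN⟩ : ∃ N : Closed, N.1 = ofPure M := ⟨⟨_, hc⟩, rfl⟩
  have h : ∀ ρ, ellP.Conv (ellP.interp ρ M) ↔ ellP.Conv N := fun ρ => by
    have hden : denC (ellP.interp ρ M) = denC N := by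
      refine (denC_interp ρ M).trans (Eq.trans ?_ (den_closed N.2 (fun x => denC (ρ x)) _))
      rw [hN, den, toCL_ofPure]
      rfl
    rw [conv_iff_denC, conv_iff_denC, hden]
  have : Nonempty Closed := ⟨IC⟩
  rw [forall_congr' h, forall_const, ellP_conv, hN]
  exact ⟨fun ⟨V, hV⟩ => let ⟨W, _, hW⟩ := eval_of_eval_ofPure hV M rfl; ⟨W, hW⟩,
    fun ⟨V, hV⟩ => ⟨_, eval_ofPure hV⟩⟩

theorem ellP_convTest : ellP.ConvTestDefinable := by
  let c : Closed := ⟨lam 0 (app (app P (var 0)) (var 0)), by decide⟩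
  have hc : ∀ x, denC (ellP.app c x) = guard (denC x ≠ ⊥) := fun x => by
    rw [denC_app, denC, domApp_den_lam, den_app, den_app,
      show den _ P = domPar from rfl, domPar_app_app, or_self]
    rfl
  refine ⟨c, ellP_conv.2 ⟨_, .lam _ _⟩, fun x hx => ?_, fun x hx => equiv_of_denC_eq ?_⟩
  · rwa [QATS.Div, conv_iff_denC, hc, guard_ne_bot_iff, ← conv_iff_denC]
  · rw [hc, guard_pos (conv_iff_denC.1 hx), LTS.i, denC_app, denC_app, denC_s, denC_k, ← dom_app,
      ← dom_app]
    exact dom_i.symm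

theorem ellP_parConv : ellP.ParConvDefinable := by
  have hP : ∀ x y, ellP.Conv (ellP.app (ellP.app PC x) y) ↔ ellP.Conv x ∨ ellP.Conv y :=
    fun x y => by
      rw [conv_iff_denC, denC_app, denC_app, show denC PC = domPar from rfl, domPar_app_app,
        guard_ne_bot_iff, conv_iff_denC, conv_iff_denC]
  refine ⟨PC, ellP_conv.2 ⟨_, .par⟩, fun x => ?_, fun x y hx => (hP x y).2 (.inl hx),
    fun x y hy => (hP x y).2 (.inr hy), fun x y hx hy h => ((hP x y).1 h).elim hx hy⟩
  rw [conv_iff_denC, denC_app]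
  exact domPar_app_ne_bot _

theorem ellP_fullyAbstract : ellP.FullyAbstract :=
  ((LTS.tfae_of_isLTS ellP_isLTS ellP_sensible ellP_approximable ellP_convTest).out 0 4).1
    ellP_parConv

end PLam

end LazyLambda

theorem mainTheorem10 :
    (∀ (A : Type*) (𝒜 : LazyLambda.LTS A), 𝒜.IsLTS → 𝒜.Sensible → 𝒜.Approximable →
      𝒜.ConvTestDefinable →
      List.TFAE [
        𝒜.ParConvDefinable,
        𝒜.Expressive,
        𝒜.Complete,
        ∃ t : A → LazyLambda.Dom, 𝒜.IsCanonicalMap t ∧ 𝒜.IsCombinatoryEmbedding t ∧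
          {d | IsCompactElement d} ⊆ Set.range t,
        𝒜.FullyAbstract]) ∧
    LazyLambda.PLam.ellP.IsLTS ∧ LazyLambda.PLam.ellP.FullyAbstract :=
  ⟨fun _ _ h hS hA hC => LazyLambda.LTS.tfae_of_isLTS h hS hA hC, LazyLambda.PLam.ellP_isLTS,
    LazyLambda.PLam.ellP_fullyAbstract⟩
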